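/- Let $w_n$ ($n\ge 0$) be the Walsh--Paley functions on $\mathbb I=[0,1)$: $w_n(x)=(-1)^{\sum_{j\ge 0}\varepsilon_j(n)x_j}$, where $n=\sum_j\varepsilon_j(n)2^j$ and $x=\sum_j x_j2^{-j-1}$ are the binary expansions (for a dyadic rational $x$, the expansion terminating in zeros). For $f\in L_1(\mathbb I)$ let $\widehat f(i)=\int_{\mathbb I}f\,w_i$ and $S_k(f;x)=\sum_{i=0}^{k-1}\widehat f(i)w_i(x)$. For $0<p<\infty$ the dyadic Hardy space $H_p(\mathbb I)$ consists of all $f\in L_1(\mathbb I)$ with $\|f\|_{H_p}:=\big\|\sup_{n\ge 0}|S_{2^n}(f)|\big\|_p<\infty$. Let $\{q_k\}_{k\ge 0}$ be a non-increasing sequence of positive real numbers, and put $Q_n=\sum_{k=0}^{n-1}q_k$ and $$t_n(f;x)=\frac1{Q_n}\sum_{k=1}^{n}q_{n-k}S_k(f;x)\quad(n\ge 1),\qquad t^*(f;x)=\sup_{n\ge 1}|t_n(f;x)|.$$ For $n\ge 1$ let $|n|$ be the integer with $2^{|n|}\le n<2^{|n|+1}$. Then the following three conditions are equivalent: 1.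 $t^*$ is bounded from $L_\infty(\mathbb I)$ to $L_\infty(\mathbb I)$, i.e. there is a finite constant $C$ with $\|t^*(f)\|_\infty\le C\|f\|_\infty$ for all $f\in L_\infty(\mathbb I)$; 2. $t^*$ is bounded from $H_1(\mathbb I)$ to $L_1(\mathbb I)$, i.e. there is a finite constant $C$ with $\|t^*(f)\|_1\le C\|f\|_{H_1}$ for all $f\in H_1(\mathbb I)$; 3. $\displaystyle\sup_{n\ge 1}\frac1{Q_n}\sum_{k=1}^{|n|}Q_{2^k}<\infty.$ -/

import Mathlib

open scoped NNReal ENNReal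

noncomputable section

namespace WalshNorlund

/-- Lebesgue measure on the unit interval `[0, 1)`. -/
def unitMeasure : MeasureTheory.Measure ℝ :=
  MeasureTheory.volume.restrict (Set.Ico 0 1)

/-- The dyadic digit `x_j` of `x = ∑ x_j 2^{-(j+1)}` in `[0, 1)`; for a dyadic rational
`Real.digits` selects the expansion that terminates in zeros. -/
def dyadicDigit (x : ℝ) (j : ℕ) : ℕ := (Real.digits x 2 j : ℕ)

/-- The binary coefficient `ε_j(n)` of `n = ∑ ε_j(n) 2^j`. -/
def binCoeff (n j : ℕ) : ℕ := n / 2 ^ j % 2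

/-- The order `|n|`: `2^{|n|} ≤ n < 2^{|n|+1}` for `n ≥ 1`. -/
def order (n : ℕ) : ℕ := Nat.log 2 n

/-- The Walsh-Paley function `w_n`. The digits `ε_j(n)` with `j > |n|` vanish, so the sum in the
exponent is over `j ≤ |n|`. -/
def walsh (n : ℕ) (x : ℝ) : ℝ :=
  (-1) ^ (∑ j ∈ Finset.range (order n + 1), binCoeff n j * dyadicDigit x j)

/-- The Walsh-Fourier coefficient of `f`. -/
def coeff (f : ℝ → ℝ) (i : ℕ) : ℝ := ∫ t, f t * walsh i t ∂unitMeasure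

/-- The partial sum `S_M(f; x)` of the Walsh-Fourier series. -/
def partialSum (f : ℝ → ℝ) (M : ℕ) (x : ℝ) : ℝ :=
  ∑ i ∈ Finset.range M, coeff f i * walsh i x

/-- The dyadic maximal function `sup_n |S_{2^n}(f; x)|`. -/
def dyadicMaximal (f : ℝ → ℝ) (x : ℝ) : ℝ≥0∞ :=
  ⨆ n : ℕ, ‖partialSum f (2 ^ n) x‖ₑ

/-- The (quasi)norm `‖f‖_{H_p} = ‖sup_n |S_{2^n}(f)|‖_p` of the dyadic Hardy space. -/
def hardyNorm (f : ℝ → ℝ) (p : ℝ≥0∞) : ℝ≥0∞ :=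
  MeasureTheory.eLpNorm (dyadicMaximal f) p unitMeasure

/-- Membership in the dyadic Hardy space `H_p`. -/
def MemHardy (f : ℝ → ℝ) (p : ℝ≥0∞) : Prop :=
  MeasureTheory.MemLp f 1 unitMeasure ∧ hardyNorm f p < ∞

/-- `Q_n = q_0 + ⋯ + q_{n-1}`. -/
def weightSum (q : ℕ → ℝ) (n : ℕ) : ℝ := ∑ k ∈ Finset.range n, q k

/-- The Nörlund mean `t_n(f; x) = Q_n⁻¹ ∑_{k=1}^n q_{n-k} S_k(f; x)`. -/
def norlundMean (q : ℕ → ℝ) (n : ℕ) (f : ℝ → ℝ) (x : ℝ) : ℝ :=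
  1 / weightSum q n * ∑ k ∈ Finset.Icc 1 n, q (n - k) * partialSum f k x

/-- The maximal operator `t^*(f; x) = sup_{n ≥ 1} |t_n(f; x)|`, with values in `[0, ∞]`. -/
def norlundMaximal (q : ℕ → ℝ) (f : ℝ → ℝ) (x : ℝ) : ℝ≥0∞ :=
  ⨆ n : ℕ, ⨆ _ : 1 ≤ n, ‖norlundMean q n f x‖ₑ

/-- `T` is bounded from `L_p` to `L_p` on `[0, 1)`. -/
def BoundedLpLp (T : (ℝ → ℝ) → ℝ → ℝ≥0∞) (p : ℝ≥0∞) : Prop :=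
  ∃ C : ℝ≥0, ∀ f : ℝ → ℝ, MeasureTheory.MemLp f p unitMeasure →
    MeasureTheory.eLpNorm (T f) p unitMeasure ≤ C * MeasureTheory.eLpNorm f p unitMeasure

/-- `T` is bounded from the dyadic Hardy space `H_p` to `L_p` on `[0, 1)`. -/
def BoundedHardyLp (T : (ℝ → ℝ) → ℝ → ℝ≥0∞) (p : ℝ≥0∞) : Prop :=
  ∃ C : ℝ≥0, ∀ f : ℝ → ℝ, MemHardy f p →
    MeasureTheory.eLpNorm (T f) p unitMeasure ≤ C * hardyNorm f p

end WalshNorlund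

end

/-! Both operator bounds are governed by the `L_1` size of the kernels `V_n = ∑_{j<n} q_j D_{n-j}`
relative to `Q_n`, and condition 3 says that this size is under control. Walsh functions of order
below `2^L` see only the first `L` binary digits, so the analysis takes place on the finite group
`DyadicGroup L`, with constants independent of `L`.

Sufficiency. Removing the top binary digit of the order (`norlundSum_two_pow_add`) splits
`V_{2^N+m}` into a multiple of `D_{2^N}`, a copy of `V_m` up to sign, and a reflected sum `∑ q_{m+i}
D_i`. Summation by parts bounds the last one by `∑ q_{2^l} Φ_{2^l}`, where `Φ_n = D_0 + ⋯ + D_n`.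
Iterating gives the positive `majorant`, whose mean is at most a constant times `∑_{i≤N} Q_{2^i}`,
hence at most a constant times `Q_{2^N}` under condition 3. The `L_∞` bound is immediate. For `H_1`,
`exists_averaged_kernel` provides one integrable kernel that dominates the level-`M` averages of all
normalized majorants with `N ≥ M`. The maximal operator is therefore integrable on functions with
zero level-`M` averages and a modulus dominated by a function of `M` digits
(`exists_bound_of_average_eq_zero`). Stopping the dyadic martingale at the heights `2^k λ`
decomposes a function into a bounded piece and such functions, in the manner of an atomic
decomposition, with total cost controlled by the mean of the maximal function
(`exists_bound_of_maximal`).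

Necessity. For `n = 1 + 4 + ⋯ + 4^{m-1}`, pairing `V_n` with `w_n` times the indicator of a suitable
union of dyadic shells yields at least `(1/8) ∑_{j<m} Q_{4^j}` (`sum_weightSum_le_expect`). This
test function is bounded by 1, which disproves the `L_∞` bound when condition 3 fails. The function
`r_M D_{2^M}` has `H_1` norm at most 2, and its mean of order `2^M + n` is `V_n` up to sign and
normalization, which does the same for `H_1`. -/

namespace WalshNorlund

open Finset

/-! ### Walsh kernels as functions of a sign sequence -/

/-- The Walsh-Paley product `∏ r_j ^ ε_j(n)` of a sequence `r` of signs. -/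
noncomputable def paley (n : ℕ) (r : ℕ → ℝ) : ℝ :=
  ∏ j ∈ range (order n + 1), r j ^ binCoeff n j

/-- The Walsh-Dirichlet kernel. -/
noncomputable def dirichlet (k : ℕ) (r : ℕ → ℝ) : ℝ := ∑ i ∈ range k, paley i r

/-- The sum `D_0 + ⋯ + D_n`, that is, `n` times the Walsh-Fejér kernel. -/
noncomputable def fejerSum (n : ℕ) (r : ℕ → ℝ) : ℝ := ∑ k ∈ range (n + 1), dirichlet k r

/-- The unnormalized Nörlund kernel `∑_{j<n} q_j D_{n-j}`. -/
noncomputable def norlundSum (q : ℕ → ℝ) (n : ℕ) (r : ℕ → ℝ) : ℝ :=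
  ∑ j ∈ range n, q j * dirichlet (n - j) r

lemma binCoeff_eq_testBit (n j : ℕ) : binCoeff n j = (n.testBit j).toNat :=
  (Nat.toNat_testBit n j).symm

lemma binCoeff_eq_zero_of_lt {n L j : ℕ} (hn : n < 2 ^ L) (hj : L ≤ j) : binCoeff n j = 0 := by
  rw [binCoeff, Nat.div_eq_of_lt (hn.trans_le (Nat.pow_le_pow_right two_pos hj))]

lemma lt_two_pow_order (n : ℕ) : n < 2 ^ (order n + 1) := Nat.lt_pow_succ_log_self one_lt_two n

lemma paley_eq_prod_range {n L : ℕ} (hn : n < 2 ^ L) (r : ℕ → ℝ) :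
    paley n r = ∏ j ∈ range L, r j ^ binCoeff n j := by
  have key : ∀ {A B : ℕ}, n < 2 ^ A → A ≤ B →
      ∏ j ∈ range A, r j ^ binCoeff n j = ∏ j ∈ range B, r j ^ binCoeff n j := by
    intro A B hA hAB
    refine prod_subset (range_subset_range.2 hAB) fun j _ hj => ?_
    rw [binCoeff_eq_zero_of_lt hA (by simpa using hj), pow_zero]
  rcases le_total L (order n + 1) with h | h
  · exact (key hn h).symm
  · exact key (lt_two_pow_order n) h

lemma paley_zero (r : ℕ → ℝ) : paley 0 r = 1 := by
  rw [paley_eq_prod_range (L := 0) (by simp)]; simp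

/-- No carry occurs: the digits of `2^N u` sit at positions at least `N`, those of `k` below `N`. -/
lemma binCoeff_add {N k : ℕ} (u : ℕ) (hk : k < 2 ^ N) (j : ℕ) :
    binCoeff (2 ^ N * u + k) j = binCoeff (2 ^ N * u) j + binCoeff k j := by
  have h0 := Nat.testBit_two_pow_mul_add u (b := 0) (i := N) (by positivity) j
  simp only [add_zero] at h0
  simp only [binCoeff_eq_testBit, Nat.testBit_two_pow_mul_add u hk, h0]
  split_ifs with h
  · simp
  · rw [Nat.testBit_lt_two_pow (hk.trans_le (Nat.pow_le_pow_right two_pos (not_lt.1 h)))]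
    simp

lemma paley_two_pow_mul_add {N k : ℕ} (u : ℕ) (hk : k < 2 ^ N) (r : ℕ → ℝ) :
    paley (2 ^ N * u + k) r = paley (2 ^ N * u) r * paley k r := by
  have h := lt_two_pow_order (2 ^ N * u + k)
  rw [paley_eq_prod_range h, paley_eq_prod_range ((Nat.le_add_right _ _).trans_lt h),
    paley_eq_prod_range ((Nat.le_add_left _ _).trans_lt h), ← prod_mul_distrib]
  exact prod_congr rfl fun j _ => by rw [binCoeff_add u hk, pow_add]

lemma paley_two_pow (N : ℕ) (r : ℕ → ℝ) : paley (2 ^ N) r = r N := by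
  rw [paley_eq_prod_range (L := N + 1) (Nat.pow_lt_pow_right one_lt_two N.lt_succ_self),
    prod_eq_single N]
  · simp [binCoeff_eq_testBit]
  · intro j _ hj
    simp [binCoeff_eq_testBit, hj.symm]
  · simp

lemma paley_mul (n : ℕ) (r s : ℕ → ℝ) :
    paley n (fun j => r j * s j) = paley n r * paley n s := by
  simp only [paley, mul_pow, prod_mul_distrib]

lemma dirichlet_zero (r : ℕ → ℝ) : dirichlet 0 r = 0 := by simp [dirichlet]

lemma dirichlet_one (r : ℕ → ℝ) : dirichlet 1 r = 1 := by simp [dirichlet, paley_zero]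

lemma dirichlet_two_pow_mul_add (N u : ℕ) (r : ℕ → ℝ) {k : ℕ} (hk : k ≤ 2 ^ N) :
    dirichlet (2 ^ N * u + k) r = dirichlet (2 ^ N * u) r + paley (2 ^ N * u) r * dirichlet k r := by
  rw [dirichlet, sum_range_add, dirichlet, dirichlet, mul_sum]
  congr 1
  exact sum_congr rfl fun i hi =>
    paley_two_pow_mul_add u ((mem_range.1 hi).trans_le hk) r

lemma dirichlet_two_pow_add (N : ℕ) (r : ℕ → ℝ) {k : ℕ} (hk : k ≤ 2 ^ N) :
    dirichlet (2 ^ N + k) r = dirichlet (2 ^ N) r + r N * dirichlet k r := by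
  have := dirichlet_two_pow_mul_add N 1 r hk
  rwa [mul_one, paley_two_pow] at this

lemma dirichlet_two_pow_succ (N : ℕ) (r : ℕ → ℝ) :
    dirichlet (2 ^ (N + 1)) r = dirichlet (2 ^ N) r * (1 + r N) := by
  rw [pow_succ, mul_two, dirichlet_two_pow_add N r le_rfl]; ring

lemma dirichlet_two_pow (N : ℕ) (r : ℕ → ℝ) :
    dirichlet (2 ^ N) r = ∏ j ∈ range N, (1 + r j) := by
  induction N with
  | zero => simp [dirichlet_one]
  | succ N ih => rw [dirichlet_two_pow_succ, ih, prod_range_succ]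

lemma fejerSum_zero (r : ℕ → ℝ) : fejerSum 0 r = 0 := by simp [fejerSum, dirichlet_zero]

lemma fejerSum_two_pow_add (N : ℕ) (r : ℕ → ℝ) {m : ℕ} (hm : m ≤ 2 ^ N) :
    fejerSum (2 ^ N + m) r = fejerSum (2 ^ N) r + m * dirichlet (2 ^ N) r + r N * fejerSum m r := by
  induction m with
  | zero => simp [fejerSum_zero]
  | succ m ih =>
    have h1 : ∀ n, fejerSum (n + 1) r = fejerSum n r + dirichlet (n + 1) r := fun n => by
      rw [fejerSum, sum_range_succ, fejerSum]
    rw [← add_assoc, h1, ih (by omega), h1, add_assoc (2 ^ N), dirichlet_two_pow_add N r hm]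
    push_cast; ring

lemma fejerSum_two_pow_succ (N : ℕ) (r : ℕ → ℝ) :
    fejerSum (2 ^ (N + 1)) r =
      fejerSum (2 ^ N) r * (1 + r N) + 2 ^ N * dirichlet (2 ^ N) r := by
  rw [pow_succ, mul_two, fejerSum_two_pow_add N r le_rfl]; push_cast; ring

/-- A sequence of signs. -/
def IsSign (r : ℕ → ℝ) : Prop := ∀ j, r j = 1 ∨ r j = -1

lemma IsSign.abs {r : ℕ → ℝ} (hr : IsSign r) (j : ℕ) : |r j| = 1 := by
  rcases hr j with h | h <;> simp [h]

lemma IsSign.abs_paley {r : ℕ → ℝ} (hr : IsSign r) (n : ℕ) : |paley n r| = 1 := by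
  rw [paley, abs_prod]
  exact prod_eq_one fun j _ => by rw [abs_pow, hr.abs, one_pow]

lemma IsSign.paley_mul_self {r : ℕ → ℝ} (hr : IsSign r) (n : ℕ) : paley n r * paley n r = 1 := by
  rw [← abs_mul_abs_self, hr.abs_paley, one_mul]

lemma IsSign.one_add_nonneg {r : ℕ → ℝ} (hr : IsSign r) (j : ℕ) : 0 ≤ 1 + r j := by
  rcases hr j with h | h <;> norm_num [h]

lemma IsSign.dirichlet_two_pow_nonneg {r : ℕ → ℝ} (hr : IsSign r) (N : ℕ) :
    0 ≤ dirichlet (2 ^ N) r := by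
  rw [dirichlet_two_pow]
  exact prod_nonneg fun j _ => hr.one_add_nonneg j

lemma IsSign.dirichlet_two_pow_eq {r : ℕ → ℝ} (hr : IsSign r) (N : ℕ) :
    dirichlet (2 ^ N) r = if ∀ j < N, r j = 1 then 2 ^ N else 0 := by
  rw [dirichlet_two_pow]
  split_ifs with h
  · rw [prod_congr rfl fun j hj => by rw [h j (mem_range.1 hj)]]
    norm_num
  · push Not at h
    obtain ⟨j, hj, h⟩ := h
    exact prod_eq_zero (mem_range.2 hj) (by rw [(hr j).resolve_left h]; norm_num)

/-- `D_{2^N}` lives where the first `N` signs are 1, and there every Walsh function of order below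
`2^N` equals 1. -/
lemma IsSign.paley_mul_dirichlet {r : ℕ → ℝ} (hr : IsSign r) {N m : ℕ} (hm : m < 2 ^ N) :
    paley m r * dirichlet (2 ^ N) r = dirichlet (2 ^ N) r := by
  rw [hr.dirichlet_two_pow_eq]
  split_ifs with h
  · rw [paley_eq_prod_range hm, prod_eq_one, one_mul]
    intro j hj
    rw [h j (mem_range.1 hj), one_pow]
  · simp

/-- Subtracting from `2^N - 1` complements each of the `N` digits, and signs are their own inverses.
-/
lemma IsSign.paley_reflect {r : ℕ → ℝ} (hr : IsSign r) {N i : ℕ} (hi : i < 2 ^ N) :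
    paley (2 ^ N - 1 - i) r = paley (2 ^ N - 1) r * paley i r := by
  rw [paley_eq_prod_range (L := N) (by omega), paley_eq_prod_range (L := N) (by omega),
    paley_eq_prod_range hi, ← prod_mul_distrib]
  refine prod_congr rfl fun j hj => ?_
  have h1 : 2 ^ N - 1 - i = 2 ^ N - (i + 1) := by omega
  rw [h1, binCoeff_eq_testBit, binCoeff_eq_testBit, binCoeff_eq_testBit,
    Nat.testBit_two_pow_sub_succ hi, Nat.testBit_two_pow_sub_one]
  have hj' := mem_range.1 hj
  cases i.testBit j <;> rcases hr j with h | h <;> simp [h, hj']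

/-- The `k` Walsh functions removed from the top of `D_{2^N}` are reflections of the first `k` ones.
-/
lemma IsSign.dirichlet_two_pow_sub {r : ℕ → ℝ} (hr : IsSign r) {N k : ℕ} (hk : k ≤ 2 ^ N) :
    dirichlet (2 ^ N - k) r =
      dirichlet (2 ^ N) r - paley (2 ^ N - 1) r * dirichlet k r := by
  induction k with
  | zero => simp [dirichlet_zero]
  | succ k ih =>
    have h := ih (by omega)
    have h1 : 2 ^ N - k = (2 ^ N - (k + 1)) + 1 := by omega
    rw [h1, dirichlet, sum_range_succ, ← dirichlet] at h
    have h2 : paley (2 ^ N - (k + 1)) r = paley (2 ^ N - 1) r * paley k r := by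
      rw [← hr.paley_reflect (by omega : k < 2 ^ N)]; congr 1; omega
    have h3 : dirichlet (k + 1) r = dirichlet k r + paley k r := by
      rw [dirichlet, sum_range_succ, dirichlet]
    rw [h2] at h
    rw [h3]; linarith

lemma IsSign.fejerSum_two_pow_nonneg {r : ℕ → ℝ} (hr : IsSign r) (N : ℕ) :
    0 ≤ fejerSum (2 ^ N) r := by
  induction N with
  | zero => simp [fejerSum, sum_range_succ, dirichlet_one, dirichlet_zero]
  | succ N ih =>
    rw [fejerSum_two_pow_succ]
    have := hr.one_add_nonneg N
    have := hr.dirichlet_two_pow_nonneg N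
    positivity

/-- Lets multiples of `D_{2^N}` be absorbed into the Fejér sums. -/
lemma IsSign.two_pow_mul_dirichlet_le {r : ℕ → ℝ} (hr : IsSign r) (N : ℕ) :
    2 ^ N * dirichlet (2 ^ N) r ≤ 2 * fejerSum (2 ^ N) r := by
  induction N with
  | zero => simp [fejerSum, sum_range_succ, dirichlet_one, dirichlet_zero]
  | succ N ih =>
    have := hr.dirichlet_two_pow_nonneg N
    rw [fejerSum_two_pow_succ, dirichlet_two_pow_succ, pow_succ]
    rcases hr N with h | h <;> rw [h]
    · nlinarith
    · have : 0 ≤ (2 : ℝ) ^ N * dirichlet (2 ^ N) r := by positivity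
      nlinarith

/-- Each removal of a top digit costs `Φ_{2^N} + m D_{2^N} ≤ 3 Φ_{2^N}`. Keeping every `l` with `2^l
≤ n`, rather than the digits of `n` alone, makes the bound a sum of step functions of `n`, which is
the form that summation by parts can use. -/
lemma IsSign.abs_fejerSum_le {r : ℕ → ℝ} (hr : IsSign r) {N n : ℕ} (hn : n < 2 ^ N) :
    |fejerSum n r| ≤ ∑ l ∈ range N, if 2 ^ l ≤ n then 3 * fejerSum (2 ^ l) r else 0 := by
  induction N generalizing n with
  | zero =>
    have : n = 0 := by simpa using hn
    simp [this, fejerSum_zero]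
  | succ N ih =>
    rw [sum_range_succ]
    have hΦ := hr.fejerSum_two_pow_nonneg
    rcases lt_or_ge n (2 ^ N) with h | h
    · rw [if_neg (not_le.2 h), add_zero]; exact ih h
    · obtain ⟨m, rfl⟩ := Nat.exists_eq_add_of_le h
      have hm : m < 2 ^ N := by rw [pow_succ] at hn; omega
      rw [if_pos h, fejerSum_two_pow_add N r hm.le]
      have hD := hr.dirichlet_two_pow_nonneg N
      have h1 := ih hm
      have h2 : (∑ l ∈ range N, if 2 ^ l ≤ m then 3 * fejerSum (2 ^ l) r else 0) ≤
          ∑ l ∈ range N, if 2 ^ l ≤ 2 ^ N + m then 3 * fejerSum (2 ^ l) r else 0 := by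
        refine sum_le_sum fun l _ => ?_
        have := hΦ l
        split_ifs <;> linarith
      have h3 : (m : ℝ) * dirichlet (2 ^ N) r ≤ 2 ^ N * dirichlet (2 ^ N) r :=
        mul_le_mul_of_nonneg_right (by exact_mod_cast hm.le) hD
      have h4 := hr.two_pow_mul_dirichlet_le N
      have h5 : |r N * fejerSum m r| = |fejerSum m r| := by rw [abs_mul, hr.abs, one_mul]
      have h6 : |(m : ℝ) * dirichlet (2 ^ N) r| = m * dirichlet (2 ^ N) r :=
        abs_of_nonneg (by positivity)
      have h7 := abs_add_three (fejerSum (2 ^ N) r) (m * dirichlet (2 ^ N) r) (r N * fejerSum m r)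
      rw [h5, h6, abs_of_nonneg (hΦ N)] at h7
      linarith

/-! ### Summation by parts and the majorant of the Nörlund kernels -/

lemma sum_mul_eq_abel (p d : ℕ → ℝ) (m : ℕ) :
    ∑ i ∈ range (m + 1), p i * d i = p m * ∑ i ∈ range (m + 1), d i +
      ∑ i ∈ range m, (p i - p (i + 1)) * ∑ j ∈ range (i + 1), d j := by
  induction m with
  | zero => simp
  | succ m ih =>
    rw [sum_range_succ, ih, sum_range_succ d (m + 1),
      sum_range_succ (fun i => (p i - p (i + 1)) * ∑ j ∈ range (i + 1), d j) m]
    ring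

/-- Summation by parts for a sequence concentrated at the single index `a`, whose partial sums are a
step of height `c`. -/
lemma abel_step (p : ℕ → ℝ) (a : ℕ) (c : ℝ) (m : ℕ) :
    p m * (if a ≤ m then c else 0) +
      ∑ i ∈ range m, (p i - p (i + 1)) * (if a ≤ i then c else 0) =
    if a ≤ m then p a * c else 0 := by
  induction m with
  | zero =>
    by_cases h : a ≤ 0
    · obtain rfl : a = 0 := by omega
      simp
    · simp [h]
  | succ m ih =>
    rw [sum_range_succ]
    by_cases h : a ≤ m
    · simp only [h, h.trans m.le_succ, if_true] at ih ⊢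
      linarith
    · simp only [h, if_false] at ih ⊢
      by_cases h' : a ≤ m + 1
      · obtain rfl : a = m + 1 := by omega
        simp only [le_refl, if_true]; linarith
      · simp only [h', if_false]; linarith

/-- Sums against non-increasing weights are controlled through step bounds for partial sums. -/
lemma abs_sum_mul_le {p d : ℕ → ℝ} (hp : Antitone p) (hp0 : ∀ i, 0 ≤ p i) {N m : ℕ} {c : ℕ → ℝ}
    {a : ℕ → ℕ} (hd : ∀ i ≤ m, |∑ j ∈ range (i + 1), d j| ≤
      ∑ l ∈ range N, if a l ≤ i then c l else 0) :
    |∑ i ∈ range (m + 1), p i * d i| ≤ ∑ l ∈ range N, if a l ≤ m then p (a l) * c l else 0 := by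
  rw [sum_mul_eq_abel]
  -- The Abel coefficients are nonnegative, so partial sums may be replaced by their step bounds;
  -- undoing the summation by parts then evaluates `p` at each jump.
  have h1 : ∑ l ∈ range N, (if a l ≤ m then p (a l) * c l else 0) =
      p m * (∑ l ∈ range N, if a l ≤ m then c l else 0) +
        ∑ i ∈ range m, (p i - p (i + 1)) * ∑ l ∈ range N, if a l ≤ i then c l else 0 := by
    simp_rw [mul_sum]
    rw [sum_comm, ← sum_add_distrib]
    exact sum_congr rfl fun l _ => (abel_step p (a l) (c l) m).symm
  rw [h1]
  refine (abs_add_le _ _).trans (add_le_add ?_ ((abs_sum_le_sum_abs _ _).trans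
    (sum_le_sum fun i hi => ?_)))
  · rw [abs_mul, abs_of_nonneg (hp0 m)]
    exact mul_le_mul_of_nonneg_left (hd m le_rfl) (hp0 m)
  · have : 0 ≤ p i - p (i + 1) := sub_nonneg.2 (hp i.le_succ)
    rw [abs_mul, abs_of_nonneg this]
    exact mul_le_mul_of_nonneg_left (hd i (mem_range.1 hi).le) this

/-- A pointwise majorant for all unnormalized Nörlund kernels of order at most `N`. -/
noncomputable def majorant (q : ℕ → ℝ) (N : ℕ) (r : ℕ → ℝ) : ℝ :=
  ∑ i ∈ range (N + 1), (weightSum q (2 ^ (i + 1)) * dirichlet (2 ^ i) r +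
    3 * ∑ l ∈ range i, q (2 ^ l) * fejerSum (2 ^ l) r)

lemma weightSum_nonneg {q : ℕ → ℝ} (hq : ∀ k, 0 < q k) (n : ℕ) : 0 ≤ weightSum q n :=
  sum_nonneg fun k _ => (hq k).le

lemma weightSum_mono {q : ℕ → ℝ} (hq : ∀ k, 0 < q k) : Monotone (weightSum q) := fun _ _ h =>
  sum_le_sum_of_subset_of_nonneg (range_subset_range.2 h) fun k _ _ => (hq k).le

lemma weightSum_pos {q : ℕ → ℝ} (hq : ∀ k, 0 < q k) {n : ℕ} (hn : 1 ≤ n) : 0 < weightSum q n :=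
  sum_pos (fun k _ => hq k) ⟨0, mem_range.2 hn⟩

lemma weightSum_add_le {q : ℕ → ℝ} (hanti : Antitone q) (m n : ℕ) :
    weightSum q (m + n) ≤ weightSum q m + weightSum q n := by
  rw [weightSum, sum_range_add]
  exact add_le_add le_rfl (sum_le_sum fun i _ => hanti (by omega))

/-- For `j < m` the kernel `D_{n-j}` lies above `2^N` and splits by `dirichlet_two_pow_add`; for `j
= m + i` it equals `D_{2^N-i}`, which is reflected. -/
lemma norlundSum_two_pow_add (q : ℕ → ℝ) {r : ℕ → ℝ} (hr : IsSign r) {N m : ℕ} (hm : m ≤ 2 ^ N) :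
    norlundSum q (2 ^ N + m) r = weightSum q (2 ^ N + m) * dirichlet (2 ^ N) r +
      r N * norlundSum q m r -
      paley (2 ^ N - 1) r * ∑ i ∈ range (2 ^ N), q (m + i) * dirichlet i r := by
  rw [norlundSum, add_comm (2 ^ N) m, sum_range_add, weightSum, sum_range_add, norlundSum,
    add_mul, sum_mul, sum_mul, mul_sum, mul_sum]
  have h1 : ∑ j ∈ range m, q j * dirichlet (m + 2 ^ N - j) r =
      ∑ j ∈ range m, q j * dirichlet (2 ^ N) r +
        ∑ j ∈ range m, r N * (q j * dirichlet (m - j) r) := by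
    rw [← sum_add_distrib]
    refine sum_congr rfl fun j hj => ?_
    have := mem_range.1 hj
    rw [show m + 2 ^ N - j = 2 ^ N + (m - j) by omega, dirichlet_two_pow_add N r (by omega)]
    ring
  have h2 : ∑ i ∈ range (2 ^ N), q (m + i) * dirichlet (m + 2 ^ N - (m + i)) r =
      ∑ i ∈ range (2 ^ N), q (m + i) * dirichlet (2 ^ N) r -
        ∑ i ∈ range (2 ^ N), paley (2 ^ N - 1) r * (q (m + i) * dirichlet i r) := by
    rw [← sum_sub_distrib]
    refine sum_congr rfl fun i hi => ?_
    have := mem_range.1 hi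
    rw [show m + 2 ^ N - (m + i) = 2 ^ N - i by omega, hr.dirichlet_two_pow_sub this.le]
    ring
  rw [h1, h2]; ring

/-- Summation by parts against `q (m + ·)`; monotonicity then removes the shift, so that the bound
does not depend on `m`. -/
lemma abs_sum_shifted_dirichlet_le {q : ℕ → ℝ} (hpos : ∀ k, 0 < q k) (hanti : Antitone q)
    {r : ℕ → ℝ} (hr : IsSign r) (N m : ℕ) :
    |∑ i ∈ range (2 ^ N), q (m + i) * dirichlet i r| ≤
      3 * ∑ l ∈ range N, q (2 ^ l) * fejerSum (2 ^ l) r := by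
  have h2 : 2 ^ N - 1 + 1 = 2 ^ N := Nat.sub_add_cancel Nat.one_le_two_pow
  have h := abs_sum_mul_le (p := fun i => q (m + i)) (d := fun i => dirichlet i r) (N := N)
    (m := 2 ^ N - 1) (c := fun l => 3 * fejerSum (2 ^ l) r) (a := fun l => 2 ^ l)
    (fun i j hij => hanti (by omega)) (fun i => (hpos _).le)
    (fun i hi => hr.abs_fejerSum_le (by omega))
  rw [h2] at h
  refine h.trans ?_
  rw [mul_sum]
  refine sum_le_sum fun l _ => ?_
  have h0 := hr.fejerSum_two_pow_nonneg l
  have h1 : q (m + 2 ^ l) ≤ q (2 ^ l) := hanti (by omega)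
  have h3 := (hpos (2 ^ l)).le
  split_ifs
  · nlinarith
  · positivity

lemma IsSign.majorant_nonneg {q : ℕ → ℝ} (hpos : ∀ k, 0 < q k) {r : ℕ → ℝ} (hr : IsSign r)
    (N : ℕ) : 0 ≤ majorant q N r :=
  sum_nonneg fun i _ => add_nonneg
    (mul_nonneg (weightSum_nonneg hpos _) (hr.dirichlet_two_pow_nonneg i))
    (mul_nonneg (by norm_num) (sum_nonneg fun l _ =>
      mul_nonneg (hpos _).le (hr.fejerSum_two_pow_nonneg l)))

/-- Top digits are removed one after another; the majorant collects the cost of every level up to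
`N`, whether or not that digit of `n` is 1, and so serves all these orders at once. -/
lemma IsSign.abs_norlundSum_le {q : ℕ → ℝ} (hpos : ∀ k, 0 < q k) (hanti : Antitone q)
    {r : ℕ → ℝ} (hr : IsSign r) {N n : ℕ} (hn : n < 2 ^ (N + 1)) :
    |norlundSum q n r| ≤ majorant q N r := by
  have hzero : |norlundSum q 0 r| = 0 := by simp [norlundSum]
  have step : ∀ N m : ℕ, m < 2 ^ N → |norlundSum q (2 ^ N + m) r| ≤ |norlundSum q m r| +
      (weightSum q (2 ^ (N + 1)) * dirichlet (2 ^ N) r +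
        3 * ∑ l ∈ range N, q (2 ^ l) * fejerSum (2 ^ l) r) := by
    intro N m hm
    rw [norlundSum_two_pow_add q hr hm.le]
    refine (abs_sub _ _).trans ?_
    have h1 := abs_add_le (weightSum q (2 ^ N + m) * dirichlet (2 ^ N) r) (r N * norlundSum q m r)
    have h2 := abs_sum_shifted_dirichlet_le hpos hanti hr N m
    have hD := hr.dirichlet_two_pow_nonneg N
    have h3 : weightSum q (2 ^ N + m) * dirichlet (2 ^ N) r ≤
        weightSum q (2 ^ (N + 1)) * dirichlet (2 ^ N) r :=
      mul_le_mul_of_nonneg_right (weightSum_mono hpos (by rw [pow_succ]; omega)) hD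
    rw [abs_mul (paley _ r), hr.abs_paley, one_mul]
    rw [abs_mul (r N), hr.abs, one_mul,
      abs_of_nonneg (mul_nonneg (weightSum_nonneg hpos _) hD)] at h1
    linarith
  induction N generalizing n with
  | zero =>
    rcases Nat.eq_zero_or_pos n with rfl | h
    · rw [hzero]; exact hr.majorant_nonneg hpos 0
    · obtain rfl : n = 2 ^ 0 + 0 := by simp at hn ⊢; omega
      simpa [hzero, majorant] using step 0 0 (by simp)
  | succ N ih =>
    rw [majorant, sum_range_succ, ← majorant]
    rcases lt_or_ge n (2 ^ (N + 1)) with h | h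
    · refine (ih h).trans (le_add_of_nonneg_right ?_)
      exact add_nonneg
        (mul_nonneg (weightSum_nonneg hpos _) (hr.dirichlet_two_pow_nonneg _))
        (mul_nonneg (by norm_num) (sum_nonneg fun l _ =>
          mul_nonneg (hpos _).le (hr.fejerSum_two_pow_nonneg l)))
    · obtain ⟨m, rfl⟩ := Nat.exists_eq_add_of_le h
      have hm : m < 2 ^ (N + 1) := by rw [pow_succ] at hn; omega
      exact (step (N + 1) m hm).trans (add_le_add (ih hm) le_rfl)

end WalshNorlund

namespace WalshNorlund

open Finset

/-! ### The finite dyadic group -/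

/-- The group of the first `L` dyadic digits, written as signs. -/
abbrev DyadicGroup (L : ℕ) : Type := Fin L → ℤˣ

variable {L : ℕ}

/-- The sign sequence (Rademacher values) of a point. -/
noncomputable def signs (x : DyadicGroup L) (j : ℕ) : ℝ :=
  if h : j < L then ((x ⟨j, h⟩ : ℤ) : ℝ) else 1

lemma isSign_signs (x : DyadicGroup L) : IsSign (signs x) := by
  intro j
  unfold signs
  split_ifs with h
  · rcases Int.units_eq_one_or (x ⟨j, h⟩) with h | h <;> simp [h]
  · simp

lemma signs_mul (x y : DyadicGroup L) : signs (x * y) = fun j => signs x j * signs y j := by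
  funext j
  unfold signs
  split_ifs <;> simp

lemma DyadicGroup.mul_self (x : DyadicGroup L) : x * x = 1 := by
  funext j; exact Int.units_mul_self _

lemma DyadicGroup.mul_mul_cancel (x y : DyadicGroup L) : x * (x * y) = y := by
  rw [← mul_assoc, DyadicGroup.mul_self, one_mul]

/-- The point with a single nontrivial digit, at position `b`. -/
def flip (L b : ℕ) : DyadicGroup L := fun j => if (j : ℕ) = b then -1 else 1

lemma signs_flip {b : ℕ} (hb : b < L) (j : ℕ) :
    signs (flip L b) j = if j = b then -1 else 1 := by
  unfold signs flip
  split_ifs <;> first | simp | omega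

lemma paley_signs_mul (n : ℕ) (x y : DyadicGroup L) :
    paley n (signs (x * y)) = paley n (signs x) * paley n (signs y) := by
  rw [signs_mul, paley_mul]

lemma paley_signs_flip {n b : ℕ} (hn : n < 2 ^ L) (hb : b < L) :
    paley n (signs (flip L b)) = (-1) ^ binCoeff n b := by
  rw [paley_eq_prod_range hn, prod_eq_single b]
  · rw [signs_flip hb, if_pos rfl]
  · intro j _ hj
    rw [signs_flip hb, if_neg hj, one_pow]
  · intro h; exact absurd (mem_range.2 hb) h

lemma expect_mul_left (y : DyadicGroup L) (g : DyadicGroup L → ℝ) :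
    univ.expect (fun x => g (y * x)) = univ.expect fun x => g x :=
  Fintype.expect_equiv (Equiv.mulLeft y) _ _ fun _ => rfl

lemma expect_mul_right (y : DyadicGroup L) (g : DyadicGroup L → ℝ) :
    univ.expect (fun x => g (x * y)) = univ.expect fun x => g x :=
  Fintype.expect_equiv (Equiv.mulRight y) _ _ fun _ => rfl

/-- If `i` and `j` differ in digit `b`, translation by the flip of digit `b` changes the sign of the
product but not its mean. -/
lemma expect_paley_mul_paley {i j : ℕ} (hi : i < 2 ^ L) (hj : j < 2 ^ L) :
    univ.expect (fun x : DyadicGroup L => paley i (signs x) * paley j (signs x)) =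
      if i = j then 1 else 0 := by
  split_ifs with h
  · subst h
    simp_rw [(isSign_signs _).paley_mul_self]
    exact expect_const univ_nonempty 1
  · obtain ⟨b, hb⟩ : ∃ b, i.testBit b ≠ j.testBit b := by
      by_contra! H
      exact h (Nat.eq_of_testBit_eq H)
    have hbL : b < L := by
      by_contra! H
      have h2 := Nat.pow_le_pow_right two_pos H
      rw [Nat.testBit_lt_two_pow (hi.trans_le h2), Nat.testBit_lt_two_pow (hj.trans_le h2)] at hb
      exact hb rfl
    have h1 := expect_mul_right (flip L b)
      (fun x : DyadicGroup L => paley i (signs x) * paley j (signs x))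
    have h2 : ∀ x : DyadicGroup L, paley i (signs (x * flip L b)) * paley j (signs (x * flip L b)) =
        (-1) * (paley i (signs x) * paley j (signs x)) := by
      intro x
      rw [paley_signs_mul, paley_signs_mul, paley_signs_flip hi hbL, paley_signs_flip hj hbL,
        binCoeff_eq_testBit, binCoeff_eq_testBit]
      revert hb
      cases i.testBit b <;> cases j.testBit b <;> simp
    simp_rw [h2, ← mul_expect] at h1
    linarith

/-! ### Convolution algebra on the finite group. -/

/-- Convolution on the dyadic group. -/
noncomputable def conv (K f : DyadicGroup L → ℝ) (x : DyadicGroup L) : ℝ :=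
  univ.expect fun y => K (x * y) * f y

lemma conv_comm (K f : DyadicGroup L → ℝ) : conv K f = conv f K := by
  funext x
  unfold conv
  rw [← expect_mul_left x]
  exact expect_congr rfl fun y _ => by rw [DyadicGroup.mul_mul_cancel, mul_comm]

lemma conv_assoc (A B f : DyadicGroup L → ℝ) : conv (conv A B) f = conv A (conv B f) := by
  funext x
  unfold conv
  simp_rw [expect_mul, mul_expect]
  rw [expect_comm]
  conv_rhs => rw [expect_comm]
  rw [expect_comm]
  refine expect_congr rfl fun z _ => ?_
  rw [← expect_mul_right z]
  refine expect_congr rfl fun y _ => ?_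
  rw [show x * z * (y * z) = x * y * (z * z) by ac_rfl, DyadicGroup.mul_self, mul_one, mul_assoc]

lemma expect_conv (A B : DyadicGroup L → ℝ) :
    univ.expect (conv A B) = univ.expect A * univ.expect B := by
  unfold conv
  rw [expect_mul_expect, expect_comm]
  conv_rhs => rw [expect_comm]
  refine expect_congr rfl fun y _ => ?_
  exact expect_mul_right y fun x => A x * B y

lemma conv_mono_left {A A' f : DyadicGroup L → ℝ} (h : ∀ x, A x ≤ A' x) (hf : ∀ x, 0 ≤ f x)
    (x : DyadicGroup L) : conv A f x ≤ conv A' f x :=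
  expect_le_expect fun y _ => mul_le_mul_of_nonneg_right (h _) (hf y)

lemma conv_add_right (K f g : DyadicGroup L → ℝ) (x : DyadicGroup L) :
    conv K (fun y => f y + g y) x = conv K f x + conv K g x := by
  simp only [conv, mul_add, expect_add_distrib]

lemma conv_sum_right {ι : Type*} (s : Finset ι) (K : DyadicGroup L → ℝ)
    (f : ι → DyadicGroup L → ℝ) (x : DyadicGroup L) :
    conv K (fun y => ∑ i ∈ s, f i y) x = ∑ i ∈ s, conv K (f i) x := by
  simp only [conv, mul_sum, expect_sum_comm]

lemma conv_sum_left {ι : Type*} (s : Finset ι) (K : ι → DyadicGroup L → ℝ)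
    (f : DyadicGroup L → ℝ) (x : DyadicGroup L) :
    conv (fun y => ∑ i ∈ s, K i y) f x = ∑ i ∈ s, conv (K i) f x := by
  simp only [conv, sum_mul, expect_sum_comm]

lemma conv_const_mul_left (c : ℝ) (K f : DyadicGroup L → ℝ) (x : DyadicGroup L) :
    conv (fun y => c * K y) f x = c * conv K f x := by
  simp only [conv, mul_expect, mul_assoc]

lemma conv_const_mul_right (c : ℝ) (K f : DyadicGroup L → ℝ) (x : DyadicGroup L) :
    conv K (fun y => c * f y) x = c * conv K f x := by
  simp only [conv, mul_expect, mul_left_comm]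

lemma abs_conv_le {K V f h : DyadicGroup L → ℝ} (hK : ∀ x, |K x| ≤ V x) (hf : ∀ x, |f x| ≤ h x)
    (x : DyadicGroup L) : |conv K f x| ≤ conv V h x := by
  refine (abs_expect_le _ _).trans (expect_le_expect fun y _ => ?_)
  rw [abs_mul]
  exact mul_le_mul (hK _) (hf _) (abs_nonneg _) ((abs_nonneg _).trans (hK _))

/-! ### Dirichlet and Fejér kernels under convolution. -/

/-- The Dirichlet kernel on the dyadic group. -/
noncomputable def dirichletKernel (L k : ℕ) (x : DyadicGroup L) : ℝ := dirichlet k (signs x)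

lemma expect_dirichlet_mul_dirichlet {k l : ℕ} (hk : k ≤ 2 ^ L) (hl : l ≤ 2 ^ L) :
    univ.expect (fun x : DyadicGroup L => dirichlet k (signs x) * dirichlet l (signs x)) =
      (min k l : ℕ) := by
  simp_rw [dirichlet, sum_mul_sum]
  rw [expect_sum_comm]
  simp_rw [expect_sum_comm]
  rw [sum_congr rfl fun i hi => sum_congr rfl fun j hj => expect_paley_mul_paley
    ((mem_range.1 hi).trans_le hk) ((mem_range.1 hj).trans_le hl)]
  simp_rw [sum_ite_eq, mem_range]
  rw [← sum_filter, sum_const, nsmul_one]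
  congr 1
  rw [show (range k).filter (· < l) = range (min k l) by ext; simp, card_range]

/-- Partial sum operators are nested orthogonal projections. In particular convolution with
`D_{2^M}` is averaging at level `M`. -/
lemma conv_dirichlet_dirichlet {k l : ℕ} (hk : k ≤ 2 ^ L) (hl : l ≤ 2 ^ L) :
    conv (dirichletKernel L k) (dirichletKernel L l) = dirichletKernel L (min k l) := by
  funext x
  simp only [conv, dirichletKernel, dirichlet, sum_mul_sum, paley_signs_mul]
  rw [expect_sum_comm]
  simp_rw [expect_sum_comm, mul_assoc, ← mul_expect]
  rw [sum_congr rfl fun i hi => sum_congr rfl fun j hj => by rw [expect_paley_mul_paley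
    ((mem_range.1 hi).trans_le hk) ((mem_range.1 hj).trans_le hl)]]
  simp_rw [mul_ite, mul_one, mul_zero, sum_ite_eq, mem_range]
  rw [← sum_filter]
  congr 1
  ext; simp

lemma expect_dirichlet {k : ℕ} (hk1 : 1 ≤ k) (hk : k ≤ 2 ^ L) :
    univ.expect (dirichletKernel L k) = 1 := by
  have := expect_dirichlet_mul_dirichlet hk (Nat.one_le_two_pow (n := L))
  simp only [dirichlet_one, mul_one, min_eq_right hk1, Nat.cast_one] at this
  exact this

/-- The kernels `D_0 + ⋯ + D_n` on the dyadic group. -/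
noncomputable def fejerKernel (L n : ℕ) (x : DyadicGroup L) : ℝ := fejerSum n (signs x)

lemma fejerKernel_eq (L n : ℕ) :
    fejerKernel L n = fun x => ∑ k ∈ range (n + 1), dirichletKernel L k x := rfl

lemma expect_fejer {n : ℕ} (hn : n ≤ 2 ^ L) : univ.expect (fejerKernel L n) = n := by
  rw [fejerKernel_eq, expect_sum_comm, sum_range_succ']
  rw [sum_congr rfl fun k hk => expect_dirichlet (by omega)
    ((Nat.succ_le_of_lt (mem_range.1 hk)).trans hn)]
  simp [dirichletKernel, dirichlet_zero]

lemma conv_dirichlet_fejer_of_le {n l : ℕ} (hn : n ≤ l) (hl : l ≤ 2 ^ L) :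
    conv (dirichletKernel L l) (fejerKernel L n) = fejerKernel L n := by
  funext x
  rw [fejerKernel_eq, conv_sum_right]
  refine sum_congr rfl fun k hk => ?_
  have := mem_range.1 hk
  rw [conv_dirichlet_dirichlet hl (by omega), min_eq_right (by omega)]

lemma conv_dirichlet_fejer_of_ge {n l : ℕ} (hn : n ≤ 2 ^ L) (hl : l ≤ n) (x : DyadicGroup L) :
    conv (dirichletKernel L l) (fejerKernel L n) x =
      fejerKernel L l x + (n - l : ℝ) * dirichletKernel L l x := by
  obtain ⟨m, rfl⟩ := Nat.exists_eq_add_of_le hl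
  simp only [fejerKernel_eq]
  rw [conv_sum_right, show l + m + 1 = (l + 1) + m by ring, sum_range_add]
  congr 1
  · refine sum_congr rfl fun k hk => ?_
    have := mem_range.1 hk
    rw [conv_dirichlet_dirichlet (by omega) (by omega), min_eq_right (by omega)]
  · rw [sum_congr rfl fun k hk => by
      have := mem_range.1 hk
      rw [conv_dirichlet_dirichlet (by omega) (by omega), min_eq_left (by omega)]]
    simp

end WalshNorlund

namespace WalshNorlund

open Finset

variable {L : ℕ}

/-! ### Kernel estimates under the condition on the weights -/

/-- The dyadic form of the growth condition on the weights. -/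
def GrowthBound (q : ℕ → ℝ) (C : ℝ) : Prop :=
  ∀ N : ℕ, ∑ i ∈ range (N + 1), weightSum q (2 ^ i) ≤ C * weightSum q (2 ^ N)

/-- Cauchy condensation: `q_{2^{l+1}} 2^l` is at most the sum of `q` over the dyadic block from
`2^l` to `2^{l+1} - 1`. -/
lemma sum_two_pow_mul_le {q : ℕ → ℝ} (hpos : ∀ k, 0 < q k) (hanti : Antitone q) (i : ℕ) :
    ∑ l ∈ range i, q (2 ^ l) * 2 ^ l ≤ 2 * weightSum q (2 ^ i) := by
  have key : ∀ i : ℕ, ∑ l ∈ range (i + 1), q (2 ^ l) * 2 ^ l ≤ 2 * weightSum q (2 ^ i) := by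
    intro i
    induction i with
    | zero =>
      have h1 := hanti (zero_le_one (α := ℕ))
      have h2 := hpos 0
      simp only [weightSum, zero_add, range_one, sum_singleton, pow_zero, mul_one]
      linarith
    | succ i ih =>
      rw [sum_range_succ]
      have h : weightSum q (2 ^ (i + 1)) = weightSum q (2 ^ i) +
          ∑ k ∈ range (2 ^ i), q (2 ^ i + k) := by
        rw [weightSum, pow_succ, mul_two, sum_range_add, weightSum]
      have h2 : ∑ k ∈ range (2 ^ i), q (2 ^ (i + 1)) ≤ ∑ k ∈ range (2 ^ i), q (2 ^ i + k) :=
        sum_le_sum fun k hk => hanti (by have := mem_range.1 hk; rw [pow_succ]; omega)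
      rw [sum_const, card_range, nsmul_eq_mul] at h2
      push_cast at h2
      rw [h, pow_succ (2 : ℝ) i]
      linarith
  rcases i with _ | i
  · simpa using weightSum_nonneg hpos 1
  · exact (key i).trans (mul_le_mul_of_nonneg_left
      (weightSum_mono hpos (Nat.pow_le_pow_right two_pos i.le_succ)) two_pos.le)

lemma weightSum_two_pow_succ_le {q : ℕ → ℝ} (hanti : Antitone q) (i : ℕ) :
    weightSum q (2 ^ (i + 1)) ≤ 2 * weightSum q (2 ^ i) := by
  rw [pow_succ, mul_two, two_mul]
  exact weightSum_add_le hanti _ _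

lemma GrowthBound.nonneg {q : ℕ → ℝ} (hpos : ∀ k, 0 < q k) {C : ℝ} (hC : GrowthBound q C) :
    0 ≤ C := by
  have h := hC 0
  have h1 := weightSum_pos hpos le_rfl
  simp only [zero_add, range_one, sum_singleton, pow_zero] at h
  by_contra! hlt
  nlinarith

/-- Each of the `N - M` terms with `M < i ≤ N` is at least `Q_{2^M}`. Thus `N - M` repetitions of a
level-`M` kernel can be paid for by the ratio `Q_{2^N} / Q_{2^M}`. -/
lemma GrowthBound.sub_mul_le {q : ℕ → ℝ} (hpos : ∀ k, 0 < q k) {C : ℝ} (hC : GrowthBound q C)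
    {M N : ℕ} (hMN : M ≤ N) :
    ((N : ℝ) - M) * weightSum q (2 ^ M) ≤ C * weightSum q (2 ^ N) := by
  obtain ⟨d, rfl⟩ := Nat.exists_eq_add_of_le hMN
  refine le_trans ?_ (hC (M + d))
  rw [show M + d + 1 = (M + 1) + d by ring, sum_range_add]
  refine le_trans ?_ (le_add_of_nonneg_left (sum_nonneg fun i _ => weightSum_nonneg hpos _))
  have : ∑ _k ∈ range d, weightSum q (2 ^ M) ≤ ∑ k ∈ range d, weightSum q (2 ^ (M + 1 + k)) :=
    sum_le_sum fun k _ => weightSum_mono hpos (Nat.pow_le_pow_right two_pos (by omega))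
  rw [sum_const, card_range, nsmul_eq_mul] at this
  push_cast
  linarith

/-- The majorant of the Nörlund kernels on the dyadic group. -/
noncomputable def majorantKernel (L : ℕ) (q : ℕ → ℝ) (N : ℕ) (x : DyadicGroup L) : ℝ :=
  majorant q N (signs x)

/-- The weighted sum of Fejér kernels `∑_{l<i} q_{2^l} Φ_{2^l}`. -/
noncomputable def weightedFejer (L : ℕ) (q : ℕ → ℝ) (i : ℕ) (x : DyadicGroup L) : ℝ :=
  ∑ l ∈ range i, q (2 ^ l) * fejerKernel L (2 ^ l) x

lemma majorantKernel_eq (q : ℕ → ℝ) (N : ℕ) : majorantKernel L q N = fun x =>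
    ∑ i ∈ range (N + 1), (weightSum q (2 ^ (i + 1)) * dirichletKernel L (2 ^ i) x +
      3 * weightedFejer L q i x) := rfl

lemma fejerKernel_nonneg (l : ℕ) (x : DyadicGroup L) : 0 ≤ fejerKernel L (2 ^ l) x :=
  (isSign_signs x).fejerSum_two_pow_nonneg l

lemma dirichletKernel_nonneg (l : ℕ) (x : DyadicGroup L) : 0 ≤ dirichletKernel L (2 ^ l) x :=
  (isSign_signs x).dirichlet_two_pow_nonneg l

lemma weightedFejer_nonneg {q : ℕ → ℝ} (hpos : ∀ k, 0 < q k) (i : ℕ) (x : DyadicGroup L) :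
    0 ≤ weightedFejer L q i x :=
  sum_nonneg fun l _ => mul_nonneg (hpos _).le (fejerKernel_nonneg l x)

lemma expect_dirichlet_two_pow {i : ℕ} (hi : i ≤ L) :
    univ.expect (dirichletKernel L (2 ^ i)) = 1 :=
  expect_dirichlet Nat.one_le_two_pow (Nat.pow_le_pow_right two_pos hi)

lemma expect_weightedFejer_le {q : ℕ → ℝ} (hpos : ∀ k, 0 < q k) (hanti : Antitone q) {i : ℕ}
    (hi : i ≤ L) : univ.expect (weightedFejer L q i) ≤ 2 * weightSum q (2 ^ i) := by
  unfold weightedFejer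
  rw [expect_sum_comm]
  refine le_trans (le_of_eq (sum_congr rfl fun l hl => ?_)) (sum_two_pow_mul_le hpos hanti i)
  rw [← mul_expect, expect_fejer (Nat.pow_le_pow_right two_pos ((mem_range.1 hl).le.trans hi))]
  push_cast; rfl

lemma expect_majorantKernel_le {q : ℕ → ℝ} (hpos : ∀ k, 0 < q k) (hanti : Antitone q) {C : ℝ}
    (hC : GrowthBound q C) {N : ℕ} (hN : N ≤ L) :
    univ.expect (majorantKernel L q N) ≤ 8 * C * weightSum q (2 ^ N) := by
  rw [majorantKernel_eq, expect_sum_comm]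
  have h : ∀ i ∈ range (N + 1), univ.expect (fun x : DyadicGroup L =>
      weightSum q (2 ^ (i + 1)) * dirichletKernel L (2 ^ i) x + 3 * weightedFejer L q i x) ≤
      8 * weightSum q (2 ^ i) := by
    intro i hi
    have hi' : i ≤ L := (Nat.lt_succ_iff.1 (mem_range.1 hi)).trans hN
    rw [expect_add_distrib, ← mul_expect, ← mul_expect, expect_dirichlet_two_pow hi']
    have h1 := weightSum_two_pow_succ_le hanti i
    have h2 := expect_weightedFejer_le (L := L) hpos hanti hi'
    -- The 8 is 2 from doubling `Q_{2^i}` plus `3 · 2` from the Fejér part.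
    linarith
  refine (sum_le_sum h).trans ?_
  rw [← mul_sum]
  linarith [hC N]

lemma conv_dirichlet_two_pow {M i : ℕ} (hM : M ≤ L) (hi : i ≤ L) :
    conv (dirichletKernel L (2 ^ M)) (dirichletKernel L (2 ^ i)) =
      dirichletKernel L (2 ^ min M i) := by
  rw [conv_dirichlet_dirichlet (Nat.pow_le_pow_right two_pos hM)
    (Nat.pow_le_pow_right two_pos hi)]
  rcases le_total M i with h | h
  · rw [min_eq_left h, min_eq_left (Nat.pow_le_pow_right two_pos h)]
  · rw [min_eq_right h, min_eq_right (Nat.pow_le_pow_right two_pos h)]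

/-- Averaging at level `M` replaces each `D_k` with `k > 2^M` by `D_{2^M}`. -/
lemma conv_fejer_two_pow_le {M l : ℕ} (hM : M ≤ L) (hl : l ≤ L) (x : DyadicGroup L) :
    conv (dirichletKernel L (2 ^ M)) (fejerKernel L (2 ^ l)) x ≤
      fejerKernel L (2 ^ min l M) x + 2 ^ l * dirichletKernel L (2 ^ M) x := by
  have hD := dirichletKernel_nonneg M x
  rcases le_total l M with h | h
  · rw [conv_dirichlet_fejer_of_le (Nat.pow_le_pow_right two_pos h)
      (Nat.pow_le_pow_right two_pos hM), min_eq_left h]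
    have : 0 ≤ (2 : ℝ) ^ l * dirichletKernel L (2 ^ M) x := by positivity
    linarith
  · rw [conv_dirichlet_fejer_of_ge (Nat.pow_le_pow_right two_pos hl)
      (Nat.pow_le_pow_right two_pos h), min_eq_right h]
    push_cast
    have : 0 ≤ (2 : ℝ) ^ M * dirichletKernel L (2 ^ M) x := by positivity
    linarith

/-- For `l ≥ M` the kernel no longer depends on `l`; writing `Φ_{2^M} ≤ 2^l (2^M)⁻¹ Φ_{2^M}` makes
the remaining weights summable by condensation. -/
lemma sum_fejer_min_le {q : ℕ → ℝ} (hpos : ∀ k, 0 < q k) (hanti : Antitone q) (M i : ℕ)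
    (x : DyadicGroup L) :
    ∑ l ∈ range i, q (2 ^ l) * fejerKernel L (2 ^ min l M) x ≤
      weightedFejer L q (min i M) x +
        2 * weightSum q (2 ^ i) * ((2 ^ M)⁻¹ * fejerKernel L (2 ^ M) x) := by
  have hΦ := fejerKernel_nonneg M x
  have hs := sum_two_pow_mul_le hpos hanti i
  have hz : 0 ≤ (2 ^ M : ℝ)⁻¹ * fejerKernel L (2 ^ M) x := by positivity
  refine le_trans ?_ (add_le_add_right (mul_le_mul_of_nonneg_right hs hz) _)
  rcases le_total i M with h | h
  · rw [min_eq_left h]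
    refine le_trans (le_of_eq ?_) (le_add_of_nonneg_right (mul_nonneg
      (sum_nonneg fun l _ => mul_nonneg (hpos _).le (by positivity)) hz))
    refine sum_congr rfl fun l hl => ?_
    rw [min_eq_left ((mem_range.1 hl).le.trans h)]
  · obtain ⟨d, rfl⟩ := Nat.exists_eq_add_of_le h
    rw [min_eq_right h, sum_range_add, sum_range_add, add_mul, sum_mul, sum_mul]
    refine add_le_add (le_of_eq ?_) ?_
    · refine sum_congr rfl fun l hl => ?_
      rw [min_eq_left (mem_range.1 hl).le]
    · refine (sum_le_sum fun k _ => ?_).trans (le_add_of_nonneg_left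
        (sum_nonneg fun l _ => mul_nonneg (mul_nonneg (hpos _).le (by positivity)) hz))
      rw [min_eq_right (Nat.le_add_right _ _), mul_assoc]
      refine mul_le_mul_of_nonneg_left ?_ (hpos _).le
      rw [pow_add, show (2 : ℝ) ^ M * 2 ^ k * ((2 ^ M)⁻¹ * fejerKernel L (2 ^ M) x) =
        2 ^ k * fejerKernel L (2 ^ M) x by field_simp]
      exact le_mul_of_one_le_left hΦ (one_le_pow₀ one_le_two)

/-- A single kernel dominating the level-`M` averages of all normalized majorants of
order at least `M`. -/
lemma exists_averaged_kernel {q : ℕ → ℝ} (hpos : ∀ k, 0 < q k) (hanti : Antitone q) {C : ℝ}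
    (hC : GrowthBound q C) {M : ℕ} (hM : M ≤ L) :
    ∃ W : DyadicGroup L → ℝ, univ.expect W ≤ 28 * C ∧
      ∀ N, M ≤ N → N ≤ L → ∀ x, conv (dirichletKernel L (2 ^ M)) (majorantKernel L q N) x ≤
        weightSum q (2 ^ N) * W x := by
  have hC0 := hC.nonneg hpos
  have hQM : 0 < weightSum q (2 ^ M) := weightSum_pos hpos Nat.one_le_two_pow
  -- Blocks `i ≤ M` supply the two sums. Blocks `i > M` collapse under averaging to multiples of
  -- `D_{2^M}`, of the normalized `Φ_{2^M}`, and to `N - M` copies of the weighted Fejér sum of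
  -- level `M`. The mean is at most `14 C + 8 C + 6 C`.
  refine ⟨fun x => (weightSum q (2 ^ M))⁻¹ *
      (2 * ∑ i ∈ range (M + 1), weightSum q (2 ^ i) * dirichletKernel L (2 ^ i) x +
        3 * ∑ i ∈ range (M + 1), weightedFejer L q i x + 3 * C * weightedFejer L q M x) +
      8 * C * dirichletKernel L (2 ^ M) x + 6 * C * ((2 ^ M)⁻¹ * fejerKernel L (2 ^ M) x),
    ?_, ?_⟩
  · simp only [expect_add_distrib, ← mul_expect, expect_sum_comm]
    have h1 : ∑ i ∈ range (M + 1), weightSum q (2 ^ i) *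
        univ.expect (fun x => dirichletKernel L (2 ^ i) x) ≤ C * weightSum q (2 ^ M) := by
      refine le_trans (le_of_eq (sum_congr rfl fun i hi => ?_)) (hC M)
      rw [expect_dirichlet_two_pow ((Nat.lt_succ_iff.1 (mem_range.1 hi)).trans hM), mul_one]
    have h2 : ∑ i ∈ range (M + 1), univ.expect (fun x => weightedFejer L q i x) ≤
        2 * (C * weightSum q (2 ^ M)) := by
      refine le_trans ?_ (mul_le_mul_of_nonneg_left (hC M) two_pos.le)
      rw [mul_sum]
      exact sum_le_sum fun i hi => expect_weightedFejer_le hpos hanti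
        ((Nat.lt_succ_iff.1 (mem_range.1 hi)).trans hM)
    have h3 := expect_weightedFejer_le (L := L) hpos hanti hM
    have h4 : univ.expect (fun x => dirichletKernel L (2 ^ M) x) = 1 :=
      expect_dirichlet_two_pow hM
    have h5 : (2 ^ M : ℝ)⁻¹ * univ.expect (fun x => fejerKernel L (2 ^ M) x) = 1 := by
      rw [show univ.expect (fun x => fejerKernel L (2 ^ M) x) = ((2 ^ M : ℕ) : ℝ) from
        expect_fejer (Nat.pow_le_pow_right two_pos hM)]
      push_cast
      exact inv_mul_cancel₀ (by positivity)
    rw [h4, h5]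
    have h6 : C * univ.expect (weightedFejer L q M) ≤ C * (2 * weightSum q (2 ^ M)) :=
      mul_le_mul_of_nonneg_left h3 hC0
    have h7 : (weightSum q (2 ^ M))⁻¹ * (2 * ∑ i ∈ range (M + 1), weightSum q (2 ^ i) *
        univ.expect (fun x => dirichletKernel L (2 ^ i) x) +
        3 * ∑ i ∈ range (M + 1), univ.expect (fun x => weightedFejer L q i x) +
        3 * C * univ.expect (fun x => weightedFejer L q M x)) ≤ 14 * C := by
      rw [inv_mul_le_iff₀ hQM]
      change C * univ.expect (fun x => weightedFejer L q M x) ≤ _ at h6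
      linarith
    linarith
  · intro N hMN hN x
    have hQN : 0 < weightSum q (2 ^ N) := weightSum_pos hpos Nat.one_le_two_pow
    have hD := dirichletKernel_nonneg (L := L)
    have hU := weightedFejer_nonneg (L := L) hpos
    have hΦ := fejerKernel_nonneg (L := L)
    set A := ∑ i ∈ range (M + 1), weightSum q (2 ^ i) * dirichletKernel L (2 ^ i) x with hA
    set B := ∑ i ∈ range (M + 1), weightedFejer L q i x with hB
    set d := dirichletKernel L (2 ^ M) x with hd
    set p := (2 ^ M : ℝ)⁻¹ * fejerKernel L (2 ^ M) x with hp
    have hp0 : 0 ≤ p := mul_nonneg (by positivity) (hΦ M x)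
    have hA0 : 0 ≤ A := sum_nonneg fun i _ => mul_nonneg (weightSum_nonneg hpos _) (hD i x)
    have hB0 : 0 ≤ B := sum_nonneg fun i _ => hU i x
    -- each summand of the averaged majorant
    have hterm : ∀ i ∈ range (N + 1), conv (dirichletKernel L (2 ^ M)) (fun x =>
        weightSum q (2 ^ (i + 1)) * dirichletKernel L (2 ^ i) x + 3 * weightedFejer L q i x) x ≤
        2 * (weightSum q (2 ^ i) * dirichletKernel L (2 ^ min M i) x) +
          3 * (weightedFejer L q (min i M) x + 2 * weightSum q (2 ^ i) * p +
            2 * weightSum q (2 ^ i) * d) := by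
      intro i hi
      have hi' : i ≤ L := (Nat.lt_succ_iff.1 (mem_range.1 hi)).trans hN
      rw [conv_add_right, conv_const_mul_right, conv_const_mul_right,
        conv_dirichlet_two_pow hM hi']
      have h1 := mul_le_mul_of_nonneg_right (weightSum_two_pow_succ_le hanti i)
        (hD (min M i) x)
      have h2 : conv (dirichletKernel L (2 ^ M)) (weightedFejer L q i) x ≤
          ∑ l ∈ range i, q (2 ^ l) * fejerKernel L (2 ^ min l M) x +
            (∑ l ∈ range i, q (2 ^ l) * 2 ^ l) * d := by
        unfold weightedFejer
        rw [conv_sum_right, sum_mul, ← sum_add_distrib]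
        refine sum_le_sum fun l hl => ?_
        rw [conv_const_mul_right, mul_assoc, ← mul_add]
        exact mul_le_mul_of_nonneg_left
          (conv_fejer_two_pow_le hM ((mem_range.1 hl).le.trans hi') x) (hpos _).le
      have h3 := sum_fejer_min_le hpos hanti M i x
      have h4 := mul_le_mul_of_nonneg_right (sum_two_pow_mul_le hpos hanti i) (hD M x)
      linarith
    have hsum : conv (dirichletKernel L (2 ^ M)) (majorantKernel L q N) x ≤
        2 * ∑ i ∈ range (N + 1), weightSum q (2 ^ i) * dirichletKernel L (2 ^ min M i) x +
          3 * ∑ i ∈ range (N + 1), weightedFejer L q (min i M) x +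
          (∑ i ∈ range (N + 1), weightSum q (2 ^ i)) * (6 * p + 6 * d) := by
      rw [majorantKernel_eq, conv_sum_right]
      refine (sum_le_sum hterm).trans (le_of_eq ?_)
      rw [mul_sum, mul_sum, sum_mul, ← sum_add_distrib, ← sum_add_distrib]
      exact sum_congr rfl fun i _ => by ring
    obtain ⟨e, rfl⟩ := Nat.exists_eq_add_of_le hMN
    have h1 : ∑ i ∈ range (M + e + 1), weightSum q (2 ^ i) * dirichletKernel L (2 ^ min M i) x ≤
        A + C * weightSum q (2 ^ (M + e)) * d := by
      refine le_trans ?_ (add_le_add_right (mul_le_mul_of_nonneg_right (hC (M + e)) (hD M x)) _)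
      rw [show M + e + 1 = (M + 1) + e by ring, sum_range_add _ (M + 1) e,
        sum_range_add (fun i => weightSum q (2 ^ i)) (M + 1) e, add_mul]
      refine add_le_add (le_of_eq ?_) ((le_of_eq ?_).trans (le_add_of_nonneg_left
        (mul_nonneg (sum_nonneg fun i _ => weightSum_nonneg hpos _) (hD M x))))
      · refine sum_congr rfl fun i hi => ?_
        rw [min_eq_right (Nat.lt_succ_iff.1 (mem_range.1 hi))]
      · rw [sum_mul]
        refine sum_congr rfl fun i _ => ?_
        rw [min_eq_left (by omega)]
    have h2 : ∑ i ∈ range (M + e + 1), weightedFejer L q (min i M) x =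
        B + e * weightedFejer L q M x := by
      rw [show M + e + 1 = (M + 1) + e by ring, sum_range_add]
      congr 1
      · refine sum_congr rfl fun i hi => ?_
        rw [min_eq_left (Nat.lt_succ_iff.1 (mem_range.1 hi))]
      · rw [sum_congr rfl fun i _ => by rw [min_eq_right (by omega : M ≤ M + 1 + i)]]
        simp
    have h3 : (∑ i ∈ range (M + e + 1), weightSum q (2 ^ i)) * (6 * p + 6 * d) ≤
        C * weightSum q (2 ^ (M + e)) * (6 * p + 6 * d) :=
      mul_le_mul_of_nonneg_right (hC _) (by have := hD M x; linarith)
    have h4 := hC.sub_mul_le hpos hMN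
    push_cast at h4
    have h5 : 1 ≤ weightSum q (2 ^ (M + e)) * (weightSum q (2 ^ M))⁻¹ := by
      rw [← div_eq_mul_inv, one_le_div hQM]
      exact weightSum_mono hpos (Nat.pow_le_pow_right two_pos hMN)
    -- The number of repeated blocks is traded for the ratio of weights, which removes the
    -- dependence on `N` from `W`.
    have h6 : (e : ℝ) ≤ C * (weightSum q (2 ^ (M + e)) * (weightSum q (2 ^ M))⁻¹) := by
      rw [← mul_assoc, ← div_eq_mul_inv, le_div_iff₀ hQM]
      linarith
    set t := weightSum q (2 ^ (M + e)) * (weightSum q (2 ^ M))⁻¹ with ht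
    have h7 : (e : ℝ) * weightedFejer L q M x ≤ C * t * weightedFejer L q M x :=
      mul_le_mul_of_nonneg_right h6 (hU M x)
    have h8 : A ≤ t * A := le_mul_of_one_le_left hA0 h5
    have h9 : B ≤ t * B := le_mul_of_one_le_left hB0 h5
    rw [h2] at hsum
    calc conv (dirichletKernel L (2 ^ M)) (majorantKernel L q (M + e)) x
        ≤ 2 * (t * A + C * weightSum q (2 ^ (M + e)) * d) +
          3 * (t * B + C * t * weightedFejer L q M x) +
          C * weightSum q (2 ^ (M + e)) * (6 * p + 6 * d) := by linarith
      _ = _ := by rw [ht]; ring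

/-! ### Nörlund means on the dyadic group -/

/-- The Nörlund kernel on the dyadic group. -/
noncomputable def norlundKernel (L : ℕ) (q : ℕ → ℝ) (n : ℕ) (x : DyadicGroup L) : ℝ :=
  1 / weightSum q n * norlundSum q n (signs x)

lemma norlundKernel_eq (q : ℕ → ℝ) (n : ℕ) : norlundKernel L q n = fun x =>
    1 / weightSum q n * ∑ j ∈ range n, q j * dirichletKernel L (n - j) x := rfl

lemma conv_norlundKernel (q : ℕ → ℝ) (n : ℕ) (f : DyadicGroup L → ℝ) (x : DyadicGroup L) :
    conv (norlundKernel L q n) f x =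
      1 / weightSum q n * ∑ j ∈ range n, q j * conv (dirichletKernel L (n - j)) f x := by
  rw [norlundKernel_eq, conv_const_mul_left, conv_sum_left]
  simp only [conv_const_mul_left]

lemma abs_conv_norlundKernel_le {q : ℕ → ℝ} (hpos : ∀ k, 0 < q k) (hanti : Antitone q) {N n : ℕ}
    (h1 : 2 ^ N ≤ n) (h2 : n < 2 ^ (N + 1)) {f h : DyadicGroup L → ℝ} (hf : ∀ x, |f x| ≤ h x)
    (x : DyadicGroup L) :
    |conv (norlundKernel L q n) f x| ≤
      (weightSum q (2 ^ N))⁻¹ * conv (majorantKernel L q N) h x := by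
  rw [← conv_const_mul_left]
  refine abs_conv_le (fun y => ?_) hf x
  have hQ : 0 < weightSum q (2 ^ N) := weightSum_pos hpos Nat.one_le_two_pow
  have hQ' := weightSum_mono hpos h1
  rw [norlundKernel, abs_mul, abs_of_pos (one_div_pos.2 (hQ.trans_le hQ')), one_div]
  exact mul_le_mul (inv_anti₀ hQ hQ') ((isSign_signs y).abs_norlundSum_le hpos hanti h2)
    (abs_nonneg _) (inv_nonneg.2 hQ.le)

lemma exists_order {n : ℕ} (h1 : 1 ≤ n) (hn : n ≤ 2 ^ L) :
    ∃ N, N ≤ L ∧ 2 ^ N ≤ n ∧ n < 2 ^ (N + 1) := by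
  have h := Nat.pow_log_le_self 2 (by omega : n ≠ 0)
  refine ⟨Nat.log 2 n, ?_, h, Nat.lt_pow_succ_log_self one_lt_two n⟩
  exact (Nat.pow_le_pow_iff_right one_lt_two).1 (h.trans hn)

lemma conv_const_right (K : DyadicGroup L → ℝ) (c : ℝ) (x : DyadicGroup L) :
    conv K (fun _ => c) x = univ.expect K * c := by
  unfold conv
  rw [← expect_mul, expect_mul_left x fun y => K y]

/-- Uniform boundedness of the Nörlund means of a bounded function. -/
lemma abs_norlund_le_of_bounded {q : ℕ → ℝ} (hpos : ∀ k, 0 < q k) (hanti : Antitone q) {C : ℝ}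
    (hC : GrowthBound q C) {n : ℕ} (h1 : 1 ≤ n) (hn : n ≤ 2 ^ L) {f : DyadicGroup L → ℝ} {c : ℝ}
    (hf : ∀ x, |f x| ≤ c) (x : DyadicGroup L) :
    |conv (norlundKernel L q n) f x| ≤ 8 * C * c := by
  obtain ⟨N, hN, hN1, hN2⟩ := exists_order h1 hn
  refine (abs_conv_norlundKernel_le hpos hanti hN1 hN2 hf x).trans ?_
  have hc : 0 ≤ c := (abs_nonneg _).trans (hf x)
  rw [conv_const_right, inv_mul_le_iff₀ (weightSum_pos hpos Nat.one_le_two_pow)]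
  have := mul_le_mul_of_nonneg_right (expect_majorantKernel_le (L := L) hpos hanti hC hN) hc
  linarith

/-- The maximal estimate for functions with vanishing level-`M` averages whose modulus is dominated
by a function of the first `M` digits. -/
lemma exists_bound_of_average_eq_zero {q : ℕ → ℝ} (hpos : ∀ k, 0 < q k) (hanti : Antitone q)
    {C : ℝ} (hC : GrowthBound q C) {M : ℕ} (hM : M ≤ L) {a s : DyadicGroup L → ℝ}
    (has : ∀ x, |a x| ≤ s x) (hs : conv (dirichletKernel L (2 ^ M)) s = s)
    (ha : ∀ x, conv (dirichletKernel L (2 ^ M)) a x = 0) :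
    ∃ B : DyadicGroup L → ℝ, univ.expect B ≤ 28 * C * univ.expect s ∧
      ∀ n, 1 ≤ n → n ≤ 2 ^ L → ∀ x, |conv (norlundKernel L q n) a x| ≤ B x := by
  obtain ⟨W, hW1, hW2⟩ := exists_averaged_kernel (L := L) hpos hanti hC hM
  have hs0 : ∀ x, 0 ≤ s x := fun x => (abs_nonneg _).trans (has x)
  have h2M : 2 ^ M ≤ 2 ^ L := Nat.pow_le_pow_right two_pos hM
  have bound : ∀ N, M ≤ N → N ≤ L → ∀ x,
      (weightSum q (2 ^ N))⁻¹ * conv (majorantKernel L q N) s x ≤ conv W s x := by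
    intro N hMN hN x
    -- As `s` is fixed by averaging, `D_{2^M}` can be inserted before `s` and then moved onto the
    -- majorant.
    rw [inv_mul_le_iff₀ (weightSum_pos hpos Nat.one_le_two_pow), ← hs, ← conv_assoc,
      conv_comm (majorantKernel L q N), hs, ← conv_const_mul_left]
    exact conv_mono_left (hW2 N hMN hN) hs0 x
  refine ⟨conv W s, ?_, fun n h1 hn x => ?_⟩
  · rw [expect_conv]
    exact mul_le_mul_of_nonneg_right hW1 (expect_nonneg fun x _ => hs0 x)
  · obtain ⟨N, hN, hN1, hN2⟩ := exists_order h1 hn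
    rcases le_or_gt M N with hMN | hMN
    · exact (abs_conv_norlundKernel_le hpos hanti hN1 hN2 has x).trans (bound N hMN hN x)
    -- Orders up to `2^M` involve only partial sums that factor through the level-`M` average of
    -- `a`, which is zero.
    · have hz : conv (norlundKernel L q n) a x = 0 := by
        rw [conv_norlundKernel, sum_eq_zero, mul_zero]
        intro j hj
        have hle : n - j ≤ 2 ^ M :=
          (Nat.sub_le _ _).trans (hN2.le.trans (Nat.pow_le_pow_right two_pos hMN))
        have h3 := conv_dirichlet_dirichlet (hle.trans h2M) h2M
        rw [min_eq_left hle] at h3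
        rw [← h3, conv_assoc, show conv (dirichletKernel L (2 ^ M)) a = fun _ => 0 from funext ha,
          conv_const_right, mul_zero, mul_zero]
      rw [hz, abs_zero]
      refine le_trans ?_ (bound M le_rfl hM x)
      refine mul_nonneg (inv_nonneg.2 (weightSum_nonneg hpos _)) (expect_nonneg fun y _ =>
        mul_nonneg ((isSign_signs _).majorant_nonneg hpos M) (hs0 y))

end WalshNorlund

namespace WalshNorlund

open Finset

variable {L : ℕ}

/-! ### Functions of finitely many digits and martingale differences -/

/-- `h` depends on the first `m` digits only. -/
def DependsOnFirst (m : ℕ) (h : DyadicGroup L → ℝ) : Prop :=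
  ∀ x y, (∀ j < m, signs x j = signs y j) → h x = h y

lemma dependsOnFirst_top (h : DyadicGroup L → ℝ) : DependsOnFirst L h := by
  intro x y hxy
  congr 1
  funext j
  have := hxy j j.2
  simp only [signs, j.2, dif_pos] at this
  exact_mod_cast this

lemma DependsOnFirst.mul {m : ℕ} {g h : DyadicGroup L → ℝ} (hg : DependsOnFirst m g)
    (hh : DependsOnFirst m h) : DependsOnFirst m fun x => g x * h x := fun x y hxy => by
  change g x * h x = g y * h y
  rw [hg x y hxy, hh x y hxy]

lemma DependsOnFirst.mono {m n : ℕ} (hmn : m ≤ n) {h : DyadicGroup L → ℝ}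
    (hh : DependsOnFirst m h) : DependsOnFirst n h :=
  fun x y hxy => hh x y fun j hj => hxy j (hj.trans_le hmn)

lemma dependsOnFirst_conv_dirichlet (m : ℕ) (f : DyadicGroup L → ℝ) :
    DependsOnFirst m (conv (dirichletKernel L (2 ^ m)) f) := by
  intro x y hxy
  unfold conv
  refine expect_congr rfl fun z _ => ?_
  congr 1
  simp only [dirichletKernel, dirichlet_two_pow, signs_mul]
  exact prod_congr rfl fun j hj => by rw [hxy j (mem_range.1 hj)]

/-- `D_{2^m}` vanishes unless the two points share their first `m` digits, where `h` is constant. -/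
lemma DependsOnFirst.conv_dirichlet {m : ℕ} (hm : m ≤ L) {h : DyadicGroup L → ℝ}
    (hh : DependsOnFirst m h) : conv (dirichletKernel L (2 ^ m)) h = h := by
  funext x
  unfold conv
  have h1 : ∀ y, dirichletKernel L (2 ^ m) (x * y) * h y =
      dirichletKernel L (2 ^ m) (x * y) * h x := by
    intro y
    rw [dirichletKernel, (isSign_signs (x * y)).dirichlet_two_pow_eq]
    split_ifs with H
    · rw [hh x y fun j hj => ?_]
      have := H j hj
      rw [signs_mul] at this
      rcases isSign_signs x j with h | h <;> rcases isSign_signs y j with h' | h' <;>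
        simp [h, h'] at this ⊢ <;> norm_num at this
    · simp
  simp_rw [h1]
  rw [← expect_mul, expect_mul_left x fun y => dirichletKernel L (2 ^ m) y,
    expect_dirichlet_two_pow hm, one_mul]

lemma signs_mul_flip {j : ℕ} (hj : j < L) (x : DyadicGroup L) {i : ℕ} (hi : i < j) :
    signs (x * flip L j) i = signs x i := by
  rw [signs_mul]
  simp [signs_flip hj, hi.ne]

lemma signs_mul_flip_self {j : ℕ} (hj : j < L) (x : DyadicGroup L) :
    signs (x * flip L j) j = -signs x j := by
  rw [signs_mul]
  simp [signs_flip hj]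

/-- Martingale differences average to zero: flipping digit `j` reverses `signs y j` and leaves the
other factors alone. -/
lemma conv_dirichlet_signs_mul {m j : ℕ} (hmj : m ≤ j) (hj : j < L) {h : DyadicGroup L → ℝ}
    (hh : DependsOnFirst j h) (x : DyadicGroup L) :
    conv (dirichletKernel L (2 ^ m)) (fun y => signs y j * h y) x = 0 := by
  unfold conv
  have h1 := expect_mul_right (flip L j)
    (fun y => dirichletKernel L (2 ^ m) (x * y) * (signs y j * h y))
  have h2 : ∀ y, dirichletKernel L (2 ^ m) (x * (y * flip L j)) *
      (signs (y * flip L j) j * h (y * flip L j)) =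
      (-1) * (dirichletKernel L (2 ^ m) (x * y) * (signs y j * h y)) := by
    intro y
    have h3 : dirichletKernel L (2 ^ m) (x * (y * flip L j)) =
        dirichletKernel L (2 ^ m) (x * y) := by
      simp only [dirichletKernel, dirichlet_two_pow, ← mul_assoc]
      exact prod_congr rfl fun i hi => by
        rw [signs_mul_flip hj _ ((mem_range.1 hi).trans_le hmj)]
    rw [h3, signs_mul_flip_self hj, hh _ y fun i hi => signs_mul_flip hj y hi]
    ring
  simp_rw [h2, ← mul_expect] at h1
  linarith

/-- The average of `f` over the dyadic interval of level `m`. -/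
noncomputable def level (f : DyadicGroup L → ℝ) (m : ℕ) : DyadicGroup L → ℝ :=
  conv (dirichletKernel L (2 ^ m)) f

/-- The coefficient of the `m`-th martingale difference with respect to the sign `r_m`. -/
noncomputable def innovation (f : DyadicGroup L → ℝ) (m : ℕ) : DyadicGroup L → ℝ :=
  conv (dirichletKernel L (2 ^ m)) fun y => signs y m * f y

lemma level_succ (f : DyadicGroup L → ℝ) (m : ℕ) (x : DyadicGroup L) :
    level f (m + 1) x = level f m x + signs x m * innovation f m x := by
  simp only [level, innovation, conv, mul_expect, ← expect_add_distrib]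
  refine expect_congr rfl fun y _ => ?_
  simp only [dirichletKernel, dirichlet_two_pow_succ, signs_mul]
  ring

lemma level_top (f : DyadicGroup L → ℝ) : level f L = f :=
  (dependsOnFirst_top f).conv_dirichlet le_rfl

lemma dependsOnFirst_level (f : DyadicGroup L → ℝ) (m : ℕ) : DependsOnFirst m (level f m) :=
  dependsOnFirst_conv_dirichlet m f

lemma dependsOnFirst_innovation (f : DyadicGroup L → ℝ) (m : ℕ) :
    DependsOnFirst m (innovation f m) :=
  dependsOnFirst_conv_dirichlet m _

/-- The larger modulus of the two level-`(m+1)` averages inside a level-`m` interval. -/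
noncomputable def envelope (f : DyadicGroup L → ℝ) (m : ℕ) (x : DyadicGroup L) : ℝ :=
  |level f m x| + |innovation f m x|

lemma dependsOnFirst_envelope (f : DyadicGroup L → ℝ) (m : ℕ) :
    DependsOnFirst m (envelope f m) := fun x y hxy => by
  rw [envelope, envelope, dependsOnFirst_level f m x y hxy, dependsOnFirst_innovation f m x y hxy]

lemma abs_level_succ_le (f : DyadicGroup L → ℝ) (m : ℕ) (x : DyadicGroup L) :
    |level f (m + 1) x| ≤ envelope f m x := by
  rw [level_succ]
  refine (abs_add_le _ _).trans (le_of_eq ?_)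
  rw [abs_mul, (isSign_signs x).abs, one_mul, envelope]

/-- The two children of a level-`m` interval have averages `a + c` and `a - c`, and the larger
modulus is `|a| + |c|`. The envelope is thus known one digit early, yet attained on one child. -/
lemma envelope_le_or (f : DyadicGroup L → ℝ) {m : ℕ} (hm : m < L) (x : DyadicGroup L) :
    envelope f m x = |level f (m + 1) x| ∨ envelope f m x = |level f (m + 1) (x * flip L m)| := by
  have hx : ∀ j < m, signs (x * flip L m) j = signs x j := fun j hj => signs_mul_flip hm x hj
  rw [level_succ, level_succ, signs_mul_flip_self hm, dependsOnFirst_level f m _ x hx,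
    dependsOnFirst_innovation f m _ x hx, envelope]
  have key : ∀ a c : ℝ, |a| + |c| = |a + c| ∨ |a| + |c| = |a - c| := by
    intro a c
    rcases le_total 0 a with ha | ha <;> rcases le_total 0 c with hc | hc
    · left
      rw [abs_of_nonneg ha, abs_of_nonneg hc, abs_of_nonneg (by linarith)]
    · right
      rw [abs_of_nonneg ha, abs_of_nonpos hc, abs_of_nonneg (by linarith), sub_eq_add_neg]
    · right
      rw [abs_of_nonpos ha, abs_of_nonneg hc, abs_of_nonpos (by linarith)]; ring
    · left
      rw [abs_of_nonpos ha, abs_of_nonpos hc, abs_of_nonpos (by linarith)]; ring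
  rcases isSign_signs x m with h | h <;> rw [h]
  · simpa [← sub_eq_add_neg] using key (level f m x) (innovation f m x)
  · simpa [← sub_eq_add_neg] using (key (level f m x) (innovation f m x)).symm

/-! ### Stopped functions -/

open Classical in
/-- The indicator of the event that the envelope has stayed below `lam` up to time `m`. -/
noncomputable def running (f : DyadicGroup L → ℝ) (lam : ℝ) (m : ℕ) (x : DyadicGroup L) : ℝ :=
  if ∀ j ≤ m, envelope f j x ≤ lam then 1 else 0

open Classical in
/-- The indicator of the event that the envelope exceeds `lam` for the first time at time `m`. -/
noncomputable def firstExit (f : DyadicGroup L → ℝ) (lam : ℝ) (m : ℕ) (x : DyadicGroup L) : ℝ :=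
  if (∀ j < m, envelope f j x ≤ lam) ∧ lam < envelope f m x then 1 else 0

/-- The function stopped before its envelope exceeds `lam`, up to time `n`. -/
noncomputable def stopped (f : DyadicGroup L → ℝ) (lam : ℝ) (n : ℕ) (x : DyadicGroup L) : ℝ :=
  level f 0 x + ∑ m ∈ range n, running f lam m x * (signs x m * innovation f m x)

lemma dependsOnFirst_running (f : DyadicGroup L → ℝ) (lam : ℝ) (m : ℕ) :
    DependsOnFirst m (running f lam m) := fun x y hxy => by
  have h : (∀ j ≤ m, envelope f j x ≤ lam) ↔ ∀ j ≤ m, envelope f j y ≤ lam :=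
    forall₂_congr fun j hj => by
      rw [dependsOnFirst_envelope f j x y fun i hi => hxy i (hi.trans_le hj)]
  simp only [running, h]

lemma dependsOnFirst_firstExit (f : DyadicGroup L → ℝ) (lam : ℝ) (m : ℕ) :
    DependsOnFirst m (firstExit f lam m) := fun x y hxy => by
  have h : (∀ j < m, envelope f j x ≤ lam) ↔ ∀ j < m, envelope f j y ≤ lam :=
    forall₂_congr fun j hj => by
      rw [dependsOnFirst_envelope f j x y fun i hi => hxy i (hi.trans hj)]
  simp only [firstExit, h, dependsOnFirst_envelope f m x y hxy]

lemma stopped_eq_level (f : DyadicGroup L → ℝ) {lam : ℝ} {n : ℕ} {x : DyadicGroup L}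
    (h : ∀ m < n, envelope f m x ≤ lam) : stopped f lam n x = level f n x := by
  induction n with
  | zero => simp [stopped]
  | succ n ih =>
    rw [stopped, sum_range_succ, ← add_assoc, ← stopped, ih fun m hm => h m (by omega),
      level_succ, running, if_pos fun j hj => h j (by omega), one_mul]

/-- Stopping is decided by the envelope, before the next digit is revealed, so the martingale never
overshoots `lam`. -/
lemma abs_stopped_le (f : DyadicGroup L → ℝ) {lam : ℝ} (n : ℕ) {x : DyadicGroup L}
    (h0 : |level f 0 x| ≤ lam) : |stopped f lam n x| ≤ lam := by
  induction n with
  | zero => simpa [stopped] using h0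
  | succ n ih =>
    by_cases h : ∀ j ≤ n, envelope f j x ≤ lam
    · rw [stopped_eq_level f fun m hm => h m (by omega)]
      exact (abs_level_succ_le f n x).trans (h n le_rfl)
    · rw [stopped, sum_range_succ, ← add_assoc, ← stopped, running, if_neg h, zero_mul, add_zero]
      exact ih

lemma firstExit_nonneg (f : DyadicGroup L → ℝ) (lam : ℝ) (m : ℕ) (x : DyadicGroup L) :
    0 ≤ firstExit f lam m x := by
  unfold firstExit; split_ifs <;> simp

lemma sum_firstExit (f : DyadicGroup L → ℝ) (lam : ℝ) (n : ℕ) (x : DyadicGroup L) :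
    ((∀ m < n, envelope f m x ≤ lam) ∧ ∑ m ∈ range n, firstExit f lam m x = 0) ∨
      ∑ m ∈ range n, firstExit f lam m x = 1 := by
  induction n with
  | zero => left; simp
  | succ n ih =>
    rw [sum_range_succ]
    rcases ih with ⟨h1, h2⟩ | h
    · by_cases hn : envelope f n x ≤ lam
      · left
        refine ⟨fun m hm => ?_, ?_⟩
        · rcases Nat.lt_succ_iff_lt_or_eq.1 hm with h | rfl
          exacts [h1 m h, hn]
        · rw [h2, firstExit, if_neg fun h => absurd h.2 (not_lt.2 hn), add_zero]
      · right
        rw [h2, firstExit, if_pos ⟨h1, not_le.1 hn⟩, zero_add]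
    · right
      rw [h, firstExit, if_neg, add_zero]
      rintro ⟨h1, _⟩
      have : ∑ m ∈ range n, firstExit f lam m x = 0 := sum_eq_zero fun m hm => by
        rw [firstExit, if_neg fun h' => absurd h'.2 (not_lt.2 (h1 m (mem_range.1 hm)))]
      linarith

/-- The maximal estimate for the difference of two consecutive stopped functions. -/
lemma exists_bound_stopped_sub {q : ℕ → ℝ} (hpos : ∀ k, 0 < q k) (hanti : Antitone q)
    {C : ℝ} (hC : GrowthBound q C) (f : DyadicGroup L → ℝ) {lam : ℝ} (hlam : 0 < lam)
    (h0 : ∀ x, |level f 0 x| ≤ lam) :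
    ∃ B : DyadicGroup L → ℝ, univ.expect B ≤
        84 * C * lam * ∑ m ∈ range L, univ.expect (firstExit f lam m) ∧
      ∀ n, 1 ≤ n → n ≤ 2 ^ L → ∀ x, |conv (norlundKernel L q n)
        (fun y => stopped f (2 * lam) L y - stopped f lam L y) x| ≤ B x := by
  set a : DyadicGroup L → ℝ := fun y => stopped f (2 * lam) L y - stopped f lam L y with ha
  have ha_le : ∀ x, |a x| ≤ 3 * lam := fun x => by
    have h1 := abs_stopped_le f L ((h0 x).trans (by linarith : lam ≤ 2 * lam))
    have h2 := abs_stopped_le f L (h0 x)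
    have h3 := abs_sub (stopped f (2 * lam) L x) (stopped f lam L x)
    change |stopped f (2 * lam) L x - stopped f lam L x| ≤ _
    linarith
  -- The two stopped functions agree until the exit from `lam`, so the difference splits according
  -- to the exit time.
  have ha_sum : a = fun x => ∑ m ∈ range L, firstExit f lam m x * a x := by
    funext x
    rw [← sum_mul]
    rcases sum_firstExit f lam L x with ⟨h1, h2⟩ | h
    · rw [h2, zero_mul]
      change stopped f (2 * lam) L x - stopped f lam L x = 0
      rw [stopped_eq_level f h1, stopped_eq_level f fun m hm => (h1 m hm).trans (by linarith),
        sub_self]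
    · rw [h, one_mul]
  have key : ∀ m : ℕ, ∃ B : DyadicGroup L → ℝ, m ∈ range L → univ.expect B ≤
      28 * C * (3 * lam * univ.expect (firstExit f lam m)) ∧
      ∀ n, 1 ≤ n → n ≤ 2 ^ L → ∀ x, |conv (norlundKernel L q n)
        (fun y => firstExit f lam m y * a y) x| ≤ B x := by
    intro m
    by_cases hm : m ∈ range L
    swap
    · exact ⟨0, fun h => absurd h hm⟩
    have hmL := mem_range.1 hm
    obtain ⟨B, hB1, hB2⟩ := exists_bound_of_average_eq_zero hpos hanti hC hmL.le
      (a := fun y => firstExit f lam m y * a y) (s := fun y => 3 * lam * firstExit f lam m y)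
      (fun x => by
        rw [abs_mul, abs_of_nonneg (firstExit_nonneg f lam m x), mul_comm]
        exact mul_le_mul_of_nonneg_right (ha_le x) (firstExit_nonneg f lam m x))
      (DependsOnFirst.conv_dirichlet hmL.le fun x y hxy => by
        rw [dependsOnFirst_firstExit f lam m x y hxy])
      (fun x => by
        have h1 : (fun y => firstExit f lam m y * a y) = fun y => ∑ j ∈ range L,
            signs y j * (firstExit f lam m y *
              ((running f (2 * lam) j y - running f lam j y) * innovation f j y)) := by
          funext y
          simp only [ha, stopped, add_sub_add_left_eq_sub, ← sum_sub_distrib, mul_sum]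
          exact sum_congr rfl fun j _ => by ring
        rw [h1, conv_sum_right]
        refine sum_eq_zero fun j hj => ?_
        -- Before the exit time both functions still run and their increments cancel; from then on
        -- the increments have zero level-`m` average.
        rcases lt_or_ge j m with hjm | hmj
        · have h2 : ∀ y, firstExit f lam m y * ((running f (2 * lam) j y - running f lam j y) *
              innovation f j y) = 0 := by
            intro y
            unfold firstExit
            split_ifs with H
            · have h3 : ∀ i ≤ j, envelope f i y ≤ lam := fun i hi => H.1 i (by omega)
              rw [running, running, if_pos h3,
                if_pos fun i hi => (h3 i hi).trans (by linarith)]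
              ring
            · rw [zero_mul]
          simp [conv, h2]
        · refine conv_dirichlet_signs_mul hmj (mem_range.1 hj) ?_ x
          refine ((dependsOnFirst_firstExit f lam m).mono hmj).mul
            (DependsOnFirst.mul (fun x y hxy => ?_) (dependsOnFirst_innovation f j))
          rw [dependsOnFirst_running f _ j x y hxy, dependsOnFirst_running f _ j x y hxy])
    refine ⟨B, fun _ => ⟨?_, hB2⟩⟩
    rw [mul_expect]
    exact hB1
  choose B hB using key
  refine ⟨fun x => ∑ m ∈ range L, B m x, ?_, fun n h1 hn x => ?_⟩
  · rw [expect_sum_comm, mul_sum]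
    refine sum_le_sum fun m hm => (hB m hm).1.trans (le_of_eq (by ring))
  · rw [ha_sum, conv_sum_right]
    exact (abs_sum_le_sum_abs _ _).trans (sum_le_sum fun m hm => (hB m hm).2 n h1 hn x)

open Classical in
-- At an exit, `F > lam` at the point or at its sibling with digit `m` flipped. The exit event is
-- invariant under that flip, which costs the factor 2.
lemma sum_expect_firstExit_le {f F : DyadicGroup L → ℝ} (hF : ∀ m ≤ L, ∀ x, |level f m x| ≤ F x)
    (lam : ℝ) : ∑ m ∈ range L, univ.expect (firstExit f lam m) ≤
      2 * univ.expect fun x => if lam < F x then 1 else 0 := by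
  have h1 : ∀ m ∈ range L, univ.expect (firstExit f lam m) ≤
      2 * univ.expect fun x => firstExit f lam m x * if lam < F x then 1 else 0 := by
    intro m hm
    have hm' := mem_range.1 hm
    have h2 : ∀ x, firstExit f lam m x ≤ (firstExit f lam m x * if lam < F x then 1 else 0) +
        firstExit f lam m (x * flip L m) * if lam < F (x * flip L m) then 1 else 0 := by
      intro x
      rw [dependsOnFirst_firstExit f lam m (x * flip L m) x fun j hj => signs_mul_flip hm' x hj]
      unfold firstExit
      split_ifs with H h3 h4 h4 <;> try norm_num
      rcases envelope_le_or f hm' x with h | h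
      · exact h3 ((h ▸ H.2).trans_le (hF _ hm' x))
      · exact h4 ((h ▸ H.2).trans_le (hF _ hm' _))
    refine (expect_le_expect fun x _ => h2 x).trans (le_of_eq ?_)
    rw [expect_add_distrib, expect_mul_right (flip L m)
      fun x => firstExit f lam m x * if lam < F x then 1 else 0, two_mul]
  refine (sum_le_sum h1).trans ?_
  rw [← mul_sum, ← expect_sum_comm]
  refine mul_le_mul_of_nonneg_left (expect_le_expect fun x _ => ?_) two_pos.le
  rw [← sum_mul]
  refine mul_le_of_le_one_left (by split_ifs <;> norm_num) ?_
  rcases sum_firstExit f lam L x with h | h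
  · rw [h.2]; exact zero_le_one
  · exact h.le

open Classical in
-- A geometric sum is at most twice its largest term; this is the dyadic layer-cake bound that
-- returns `∑ λ_k P(F > λ_k)` to the mean of `F`.
lemma sum_two_pow_indicator_le {lam t : ℝ} (hlam : 0 < lam) (ht : 0 ≤ t) (K : ℕ) :
    ∑ k ∈ range K, 2 ^ k * lam * (if 2 ^ k * lam < t then 1 else 0) ≤ 2 * t := by
  have all : ∀ K : ℕ, ∑ k ∈ range K, 2 ^ k * lam * (if 2 ^ k * lam < t then 1 else 0) ≤
      2 ^ K * lam := by
    intro K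
    induction K with
    | zero => simpa using hlam.le
    | succ K ih =>
      rw [sum_range_succ, pow_succ]
      have : 0 < 2 ^ K * lam := by positivity
      split_ifs <;> linarith
  induction K with
  | zero => simpa using ht
  | succ K ih =>
    by_cases h : 2 ^ K * lam < t
    · refine (all (K + 1)).trans ?_
      rw [pow_succ]; linarith
    · rw [sum_range_succ, if_neg h, mul_zero, add_zero]; exact ih

/-- The maximal Nörlund operator on the dyadic group is bounded in mean by the dyadic maximal
function, uniformly in the number of digits. -/
lemma exists_bound_of_maximal {q : ℕ → ℝ} (hpos : ∀ k, 0 < q k) (hanti : Antitone q)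
    {C : ℝ} (hC : GrowthBound q C) {f F : DyadicGroup L → ℝ}
    (hF : ∀ m ≤ L, ∀ x, |level f m x| ≤ F x) :
    ∃ B : DyadicGroup L → ℝ, univ.expect B ≤ 344 * C * univ.expect F ∧
      ∀ n, 1 ≤ n → n ≤ 2 ^ L → ∀ x, |conv (norlundKernel L q n) f x| ≤ B x := by
  classical
  have hC0 := hC.nonneg hpos
  have hF0 : ∀ x, 0 ≤ F x := fun x => (abs_nonneg _).trans (hF 0 L.zero_le x)
  have hEF : 0 ≤ univ.expect F := expect_nonneg fun x _ => hF0 x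
  set lam := univ.expect F with hlam_def
  rcases hEF.eq_or_lt with hzero | hlam
  · have h1 : ∀ x, F x = 0 := fun x =>
      (expect_eq_zero_iff_of_nonneg fun x _ => hF0 x).1 hzero.symm x (mem_univ x)
    have h2 : f = fun _ => 0 := funext fun x => by
      have := hF L le_rfl x
      rw [level_top, h1] at this
      exact abs_nonpos_iff.1 this
    refine ⟨fun _ => 0, by rw [← hzero]; simp, fun n _ _ x => ?_⟩
    rw [h2, conv_const_right]; simp
  -- The level-0 average is constant and dominated by `F`, so the mean of `F` is an admissible
  -- lowest stopping height.
  have h0 : ∀ x, |level f 0 x| ≤ lam := fun x => by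
    have h1 : ∀ y, level f 0 x = level f 0 y := fun y =>
      dependsOnFirst_level f 0 x y fun j hj => absurd hj (Nat.not_lt_zero j)
    rw [hlam_def, ← expect_const (univ_nonempty (α := DyadicGroup L)) |level f 0 x|]
    exact expect_le_expect fun y _ => by rw [h1 y]; exact hF 0 L.zero_le y
  have hlev : ∀ k : ℕ, 0 < 2 ^ k * lam ∧ lam ≤ 2 ^ k * lam := fun k =>
    ⟨by positivity, le_mul_of_one_le_left hlam.le (one_le_pow₀ one_le_two)⟩
  choose B hB1 hB2 using fun k : ℕ => exists_bound_stopped_sub hpos hanti hC f (hlev k).1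
    fun x => (h0 x).trans (hlev k).2
  -- a level at which nothing is stopped
  obtain ⟨K, hK⟩ : ∃ K : ℕ, ∀ x, ∀ m < L, envelope f m x ≤ 2 ^ K * lam := by
    obtain ⟨K, hK⟩ := pow_unbounded_of_one_lt
      ((∑ x : DyadicGroup L, ∑ m ∈ range L, envelope f m x) / lam) (one_lt_two (α := ℝ))
    refine ⟨K, fun x m hm => ?_⟩
    rw [div_lt_iff₀ hlam] at hK
    have h1 : ∀ x m, 0 ≤ envelope f m x := fun x m => by unfold envelope; positivity
    refine le_trans ?_ hK.le
    refine (single_le_sum (fun m _ => h1 x m) (mem_range.2 hm)).trans ?_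
    exact single_le_sum (f := fun x => ∑ m ∈ range L, envelope f m x)
      (fun x _ => sum_nonneg fun m _ => h1 x m) (mem_univ x)
  have hf : f = fun x => stopped f lam L x + ∑ k ∈ range K,
      (stopped f (2 * (2 ^ k * lam)) L x - stopped f (2 ^ k * lam) L x) := by
    funext x
    have h1 := sum_range_sub (fun k => stopped f (2 ^ k * lam) L x) K
    simp only [pow_succ', mul_assoc, pow_zero, one_mul] at h1
    rw [h1, stopped_eq_level f (hK x), level_top]
    ring
  -- The bounded piece costs `8 C`. The differences cost `84 · 2 · 2 = 336` times `C`, from the exit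
  -- bound and the geometric sum, for a total of 344.
  refine ⟨fun x => 8 * C * lam + ∑ k ∈ range K, B k x, ?_, fun n h1 hn x => ?_⟩
  · rw [expect_add_distrib, expect_const univ_nonempty, expect_sum_comm]
    have h2 : ∑ k ∈ range K, univ.expect (fun x => B k x) ≤ ∑ k ∈ range K, 168 * C *
        univ.expect (fun x => 2 ^ k * lam * (if 2 ^ k * lam < F x then 1 else 0)) := by
      refine sum_le_sum fun k _ => (hB1 k).trans ?_
      rw [← mul_expect]
      have := mul_le_mul_of_nonneg_left (sum_expect_firstExit_le hF (2 ^ k * lam))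
        (mul_nonneg (mul_nonneg (by norm_num : (0 : ℝ) ≤ 84) hC0) (hlev k).1.le)
      linarith
    have h3 : ∑ k ∈ range K,
        univ.expect (fun x => 2 ^ k * lam * (if 2 ^ k * lam < F x then 1 else 0)) ≤ 2 * lam := by
      rw [← expect_sum_comm, hlam_def, mul_expect]
      exact expect_le_expect fun x _ => sum_two_pow_indicator_le hlam (hF0 x) K
    rw [← mul_sum] at h2
    have := mul_le_mul_of_nonneg_left h3 (mul_nonneg (by norm_num : (0 : ℝ) ≤ 168) hC0)
    linarith
  · conv_lhs => rw [hf]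
    rw [conv_add_right, conv_sum_right]
    refine (abs_add_le _ _).trans (add_le_add ?_ ((abs_sum_le_sum_abs _ _).trans
      (sum_le_sum fun k _ => hB2 k n h1 hn x)))
    exact abs_norlund_le_of_bounded hpos hanti hC h1 hn (fun y => abs_stopped_le f L (h0 y)) x

end WalshNorlund

namespace WalshNorlund

open Finset

variable {L : ℕ}

/-! ### Lower bounds for the Nörlund kernels -/

/-- The indicator of `[2^{-a-1}, 2^{-a})`, through Dirichlet kernels. -/
noncomputable def bump (a : ℕ) (r : ℕ → ℝ) : ℝ :=
  (2 ^ a)⁻¹ * dirichlet (2 ^ a) r - (2 ^ (a + 1))⁻¹ * dirichlet (2 ^ (a + 1)) r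

/-- The sum of the bumps at the first `m` odd positions. -/
noncomputable def testSum (m : ℕ) (r : ℕ → ℝ) : ℝ := ∑ j ∈ range m, bump (2 * j + 1) r

/-- The number `1 + 4 + ⋯ + 4^{m-1}`, with alternating binary digits. -/
def alternating (m : ℕ) : ℕ := ∑ j ∈ range m, 4 ^ j

lemma three_mul_alternating (m : ℕ) : 3 * alternating m + 1 = 4 ^ m := by
  induction m with
  | zero => simp [alternating]
  | succ m ih => rw [alternating, sum_range_succ, ← alternating, pow_succ]; omega

lemma alternating_add (i j : ℕ) : alternating (i + j) = 4 ^ i * alternating j + alternating i := by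
  simp_rw [alternating, sum_range_add, mul_sum, pow_add]
  exact add_comm _ _

lemma IsSign.bump_nonneg {r : ℕ → ℝ} (hr : IsSign r) (a : ℕ) : 0 ≤ bump a r := by
  have hD := hr.dirichlet_two_pow_nonneg a
  have h : bump a r = (2 ^ a)⁻¹ * dirichlet (2 ^ a) r * ((1 - r a) / 2) := by
    rw [bump, dirichlet_two_pow_succ, pow_succ, mul_inv]; ring
  rw [h]
  refine mul_nonneg (by positivity) ?_
  rcases hr a with h | h <;> norm_num [h]

lemma IsSign.testSum_nonneg {r : ℕ → ℝ} (hr : IsSign r) (m : ℕ) : 0 ≤ testSum m r :=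
  sum_nonneg fun _ _ => hr.bump_nonneg _

lemma IsSign.testSum_le_one {r : ℕ → ℝ} (hr : IsSign r) (m : ℕ) : testSum m r ≤ 1 := by
  have h1 : testSum m r ≤ ∑ a ∈ range (2 * m), bump a r := by
    induction m with
    | zero => simp [testSum]
    | succ m ih =>
      rw [testSum, sum_range_succ, ← testSum, show 2 * (m + 1) = 2 * m + 1 + 1 by ring,
        sum_range_succ, sum_range_succ]
      linarith [hr.bump_nonneg (2 * m)]
  refine h1.trans ?_
  have h2 := sum_range_sub' (fun a => (2 ^ a : ℝ)⁻¹ * dirichlet (2 ^ a) r) (2 * m)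
  change ∑ a ∈ range (2 * m), bump a r = _ at h2
  rw [h2]
  have := hr.dirichlet_two_pow_nonneg (2 * m)
  have h3 : 0 ≤ (2 ^ (2 * m) : ℝ)⁻¹ * dirichlet (2 ^ (2 * m)) r := by positivity
  simp only [pow_zero, inv_one, one_mul, dirichlet_one]
  linarith

/-- On the support of `D_{2^b}` only the high digits of the order matter, so the product is
`D_{2^b(v+1)} - D_{2^b v}` and orthogonality counts frequencies. -/
lemma expect_dirichlet_paley_dirichlet {b v p k : ℕ} (hp : p < 2 ^ b) (hk : k ≤ 2 ^ b * v + p)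
    (hL : 2 ^ b * (v + 1) ≤ 2 ^ L) :
    univ.expect (fun x : DyadicGroup L => dirichlet k (signs x) *
      (paley (2 ^ b * v + p) (signs x) * dirichlet (2 ^ b) (signs x))) =
      k - (min k (2 ^ b * v) : ℕ) := by
  have hL' : 2 ^ b * v + 2 ^ b ≤ 2 ^ L := by rwa [← Nat.mul_succ]
  have h1 : ∀ x : DyadicGroup L, dirichlet k (signs x) *
      (paley (2 ^ b * v + p) (signs x) * dirichlet (2 ^ b) (signs x)) =
      dirichlet k (signs x) * dirichlet (2 ^ b * v + 2 ^ b) (signs x) -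
        dirichlet k (signs x) * dirichlet (2 ^ b * v) (signs x) := by
    intro x
    rw [paley_two_pow_mul_add v hp, mul_assoc, (isSign_signs x).paley_mul_dirichlet hp,
      dirichlet_two_pow_mul_add b v _ le_rfl]
    ring
  simp_rw [h1]
  rw [expect_sub_distrib, expect_dirichlet_mul_dirichlet (by omega) hL',
    expect_dirichlet_mul_dirichlet (by omega) (by omega), min_eq_left (by omega : k ≤ _)]

/-- Since `p < 2^a`, digit `a` of the order is zero. Hence both Dirichlet kernels in the bump give
the same count, with coefficients `2^{-a}` and `2^{-a-1}`, and the difference is nonnegative. -/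
lemma expect_dirichlet_paley_bump {a u p k : ℕ} (hp : p < 2 ^ a) (hk : k ≤ 2 ^ (a + 1) * u + p)
    (hL : 2 ^ (a + 1) * (u + 1) ≤ 2 ^ L) :
    univ.expect (fun x : DyadicGroup L => dirichlet k (signs x) *
      (paley (2 ^ (a + 1) * u + p) (signs x) * bump a (signs x))) =
      (2 ^ (a + 1))⁻¹ * (k - (min k (2 ^ (a + 1) * u) : ℕ)) := by
  have h2 : 2 ^ (a + 1) * u = 2 ^ a * (2 * u) := by rw [pow_succ, mul_assoc]
  have e1 := expect_dirichlet_paley_dirichlet (L := L) (b := a + 1) (hp.trans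
    (Nat.pow_lt_pow_right one_lt_two a.lt_succ_self)) hk hL
  have e2 := expect_dirichlet_paley_dirichlet (L := L) (b := a) (v := 2 * u) hp (h2 ▸ hk) (by
    refine le_trans ?_ hL
    rw [pow_succ, mul_assoc]
    exact Nat.mul_le_mul_left _ (by omega))
  rw [← h2] at e2
  have h3 : ∀ x : DyadicGroup L, dirichlet k (signs x) *
      (paley (2 ^ (a + 1) * u + p) (signs x) * bump a (signs x)) =
      (2 ^ a)⁻¹ * (dirichlet k (signs x) *
        (paley (2 ^ (a + 1) * u + p) (signs x) * dirichlet (2 ^ a) (signs x))) -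
      (2 ^ (a + 1))⁻¹ * (dirichlet k (signs x) *
        (paley (2 ^ (a + 1) * u + p) (signs x) * dirichlet (2 ^ (a + 1)) (signs x))) := by
    intro x; rw [bump]; ring
  simp_rw [h3]
  rw [expect_sub_distrib, ← mul_expect, ← mul_expect, e1, e2, ← sub_mul]
  congr 1
  rw [pow_succ]
  field_simp
  norm_num

/-- Non-increasing weights favour small `j`, where `p - j` is large, so the weighted average of `p -
j` is at least `p / 2`. -/
lemma mul_weightSum_le {q : ℕ → ℝ} (hpos : ∀ k, 0 < q k) (hanti : Antitone q) (p : ℕ) :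
    p * weightSum q p ≤ 2 * ∑ j ∈ range p, q j * ((p : ℝ) - j) := by
  have hQ : ∀ p : ℕ, (p : ℝ) * q p ≤ weightSum q p := fun p => by
    have : ∑ _k ∈ range p, q p ≤ weightSum q p :=
      sum_le_sum fun k hk => hanti (mem_range.1 hk).le
    simpa using this
  have hq : ∀ p : ℕ, weightSum q (p + 1) = weightSum q p + q p := fun p => sum_range_succ _ _
  induction p with
  | zero => simp
  | succ p ih =>
    have h : ∑ j ∈ range (p + 1), q j * (((p + 1 : ℕ) : ℝ) - j) =
        ∑ j ∈ range p, q j * ((p : ℝ) - j) + weightSum q (p + 1) := by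
      rw [sum_range_succ, hq, weightSum]
      have : ∑ j ∈ range p, q j * (((p + 1 : ℕ) : ℝ) - j) =
          ∑ j ∈ range p, q j * ((p : ℝ) - j) + ∑ j ∈ range p, q j := by
        rw [← sum_add_distrib]
        exact sum_congr rfl fun j _ => by push_cast; ring
      rw [this]; push_cast; ring
    rw [h, hq]
    push_cast
    nlinarith [hQ p, hpos p]

lemma expect_norlundSum_paley_bump_ge {q : ℕ → ℝ} (hpos : ∀ k, 0 < q k) (hanti : Antitone q)
    {a u p : ℕ} (hp : p < 2 ^ a) (hL : 2 ^ (a + 1) * (u + 1) ≤ 2 ^ L) :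
    (2 ^ (a + 2))⁻¹ * (p * weightSum q p) ≤
      univ.expect (fun x : DyadicGroup L => norlundSum q (2 ^ (a + 1) * u + p) (signs x) *
        (paley (2 ^ (a + 1) * u + p) (signs x) * bump a (signs x))) := by
  set n := 2 ^ (a + 1) * u + p with hn
  have h1 : univ.expect (fun x : DyadicGroup L => norlundSum q n (signs x) *
      (paley n (signs x) * bump a (signs x))) =
      ∑ j ∈ range n, q j * ((2 ^ (a + 1))⁻¹ *
        (((n - j : ℕ) : ℝ) - (min (n - j) (2 ^ (a + 1) * u) : ℕ))) := by
    simp_rw [norlundSum, sum_mul]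
    rw [expect_sum_comm]
    refine sum_congr rfl fun j _ => ?_
    rw [← expect_dirichlet_paley_bump hp (Nat.sub_le n j) hL, mul_expect]
    exact expect_congr rfl fun x _ => by ring
  rw [h1]
  have h2 : ∑ j ∈ range p, q j * ((2 ^ (a + 1))⁻¹ * ((p : ℝ) - j)) ≤
      ∑ j ∈ range n, q j * ((2 ^ (a + 1))⁻¹ *
        (((n - j : ℕ) : ℝ) - (min (n - j) (2 ^ (a + 1) * u) : ℕ))) := by
    refine le_trans (le_of_eq (sum_congr rfl fun j hj => ?_))
      (sum_le_sum_of_subset_of_nonneg (range_subset_range.2 (by omega : p ≤ n)) fun j _ _ => ?_)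
    · have hj' := mem_range.1 hj
      rw [min_eq_right (by omega), hn, Nat.cast_sub (by omega)]
      push_cast; ring
    · refine mul_nonneg (hpos j).le (mul_nonneg (by positivity) (sub_nonneg.2 ?_))
      exact_mod_cast min_le_left _ _
  refine le_trans ?_ h2
  have h3 : ∑ j ∈ range p, q j * ((2 ^ (a + 1) : ℝ)⁻¹ * ((p : ℝ) - j)) =
      (2 ^ (a + 1))⁻¹ * ∑ j ∈ range p, q j * ((p : ℝ) - j) := by
    rw [mul_sum]; exact sum_congr rfl fun j _ => by ring
  rw [h3, show (2 ^ (a + 2) : ℝ)⁻¹ = (2 ^ (a + 1))⁻¹ * 2⁻¹ by rw [← mul_inv, ← pow_succ],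
    mul_assoc]
  refine mul_le_mul_of_nonneg_left ?_ (by positivity)
  linarith [mul_weightSum_le hpos hanti p]

/-- The lower bound for the Nörlund kernels of alternating order. -/
lemma sum_weightSum_le_expect {q : ℕ → ℝ} (hpos : ∀ k, 0 < q k) (hanti : Antitone q) {m : ℕ}
    (hL : 2 * m ≤ L) :
    ∑ j ∈ range m, weightSum q (4 ^ j) ≤
      8 * univ.expect (fun x : DyadicGroup L => norlundSum q (alternating m) (signs x) *
        (paley (alternating m) (signs x) * testSum m (signs x))) := by
  simp_rw [testSum, mul_sum]
  rw [expect_sum_comm, mul_sum]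
  refine sum_le_sum fun j hj => ?_
  have hj' := mem_range.1 hj
  obtain ⟨e, rfl⟩ : ∃ e, m = (j + 1) + e := Nat.exists_eq_add_of_le hj'
  have h4 : ∀ i : ℕ, 4 ^ i = 2 ^ (2 * i) := fun i => by rw [pow_mul]; norm_num
  -- Cut at position `2j + 2`: the digit at `2j + 1` is zero and the one at `2j` is 1, so the lower
  -- part lies between `4^j` and `2^{2j+1}`.
  have hn : alternating (j + 1 + e) = 2 ^ (2 * j + 1 + 1) * alternating e + alternating (j + 1) := by
    rw [alternating_add, h4, show 2 * (j + 1) = 2 * j + 1 + 1 by ring]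
  have h1 := three_mul_alternating (j + 1)
  have h2 := three_mul_alternating e
  have hp : alternating (j + 1) < 2 ^ (2 * j + 1) := by
    rw [pow_succ] at h1 ⊢
    rw [← h4]; omega
  have hp' : 4 ^ j ≤ alternating (j + 1) := by rw [pow_succ] at h1; omega
  have hLL : 2 ^ (2 * j + 1 + 1) * (alternating e + 1) ≤ 2 ^ L := by
    calc 2 ^ (2 * j + 1 + 1) * (alternating e + 1) ≤ 2 ^ (2 * j + 1 + 1) * 4 ^ e :=
          Nat.mul_le_mul_left _ (by omega)
      _ = 2 ^ (2 * (j + 1 + e)) := by rw [h4, ← pow_add]; congr 1; ring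
      _ ≤ 2 ^ L := Nat.pow_le_pow_right two_pos hL
  have key := expect_norlundSum_paley_bump_ge (L := L) hpos hanti hp hLL
  rw [← hn] at key
  have h5 : (4 : ℝ) ^ j ≤ alternating (j + 1) := by exact_mod_cast hp'
  have h6 := weightSum_mono hpos hp'
  have h7 : (4 : ℝ) ^ j * weightSum q (4 ^ j) ≤
      alternating (j + 1) * weightSum q (alternating (j + 1)) :=
    mul_le_mul h5 h6 (weightSum_nonneg hpos _) (by positivity)
  have h8 : weightSum q (4 ^ j) =
      8 * ((2 ^ (2 * j + 1 + 2) : ℝ)⁻¹ * (4 ^ j * weightSum q (4 ^ j))) := by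
    rw [show 2 * j + 1 + 2 = 2 * j + 3 by ring, pow_add, pow_mul]
    norm_num
    field_simp
  rw [h8]
  exact mul_le_mul_of_nonneg_left
    ((mul_le_mul_of_nonneg_left h7 (by positivity)).trans key) (by norm_num)

/-- The Nörlund mean of order `2^M + n` of the martingale difference `r_M D_{2^M}`. -/
lemma conv_norlundKernel_atom (q : ℕ → ℝ) {M n : ℕ} (hn : n ≤ 2 ^ M) (hM : M + 1 ≤ L)
    (x : DyadicGroup L) :
    conv (norlundKernel L q (2 ^ M + n))
      (fun y => dirichletKernel L (2 ^ (M + 1)) y + (-1) * dirichletKernel L (2 ^ M) y) x =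
      1 / weightSum q (2 ^ M + n) * (signs x M * norlundSum q n (signs x)) := by
  have hL := Nat.pow_le_pow_right two_pos hM
  have hp : 2 ^ (M + 1) = 2 ^ M + 2 ^ M := by rw [pow_succ, mul_two]
  rw [conv_norlundKernel]
  congr 1
  have h1 : ∀ k ≤ 2 ^ (M + 1), conv (dirichletKernel L k)
      (fun y => dirichletKernel L (2 ^ (M + 1)) y + (-1) * dirichletKernel L (2 ^ M) y) x =
      dirichletKernel L k x - dirichletKernel L (min k (2 ^ M)) x := by
    intro k hk
    rw [conv_add_right, conv_const_mul_right, conv_dirichlet_dirichlet (hk.trans hL) hL,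
      conv_dirichlet_dirichlet (hk.trans hL) (by omega), min_eq_left hk]
    ring
  rw [add_comm (2 ^ M) n, sum_range_add, norlundSum, mul_sum]
  conv_rhs => rw [← add_zero (∑ i ∈ range n, _)]
  congr 1
  · refine sum_congr rfl fun j hj => ?_
    have := mem_range.1 hj
    rw [h1 _ (by omega), min_eq_right (by omega), show n + 2 ^ M - j = 2 ^ M + (n - j) by omega]
    simp only [dirichletKernel]
    rw [dirichlet_two_pow_add M _ (by omega)]
    ring
  · refine sum_eq_zero fun j _ => ?_
    rw [h1 _ (by omega), min_eq_left (by omega), sub_self, mul_zero]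

/-! ### The growth condition along powers of four -/

/-- Exponents are grouped in pairs: `Q_{2·4^j} ≤ 2 Q_{4^j}`, so even and odd exponents together cost
a factor 3. -/
lemma exists_growth_of_four_pow {q : ℕ → ℝ} (hpos : ∀ k, 0 < q k) (hanti : Antitone q) {K : ℝ}
    (hK : ∀ m : ℕ, ∑ j ∈ range (m + 1), weightSum q (4 ^ j) ≤ K * weightSum q (4 ^ m)) :
    ∃ C : ℝ, ∀ n : ℕ, 1 ≤ n →
      1 / weightSum q n * ∑ k ∈ Icc 1 (order n), weightSum q (2 ^ k) ≤ C := by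
  have hK0 : 0 ≤ K := by
    have h := hK 0
    have h1 := weightSum_pos hpos le_rfl
    simp only [zero_add, range_one, sum_singleton, pow_zero] at h
    by_contra! hlt
    nlinarith
  refine ⟨3 * K, fun n hn => ?_⟩
  rw [one_div, inv_mul_le_iff₀ (weightSum_pos hpos hn)]
  set m := order n / 2 with hm
  have h4 : ∀ i : ℕ, 2 ^ (2 * i) = 4 ^ i := fun i => by rw [pow_mul]; norm_num
  have h1 : ∑ k ∈ Icc 1 (order n), weightSum q (2 ^ k) ≤
      ∑ k ∈ range (2 * (m + 1)), weightSum q (2 ^ k) := by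
    refine sum_le_sum_of_subset_of_nonneg (fun k hk => ?_) fun k _ _ => weightSum_nonneg hpos _
    have := mem_Icc.1 hk
    exact mem_range.2 (by omega)
  have h2 : ∀ m : ℕ, ∑ k ∈ range (2 * m), weightSum q (2 ^ k) ≤
      3 * ∑ j ∈ range m, weightSum q (4 ^ j) := by
    intro m
    induction m with
    | zero => simp
    | succ m ih =>
      rw [show 2 * (m + 1) = 2 * m + 1 + 1 by ring, sum_range_succ, sum_range_succ,
        sum_range_succ _ m, ← h4 m]
      have := weightSum_two_pow_succ_le hanti (2 * m)
      linarith
  have h3 : weightSum q (4 ^ m) ≤ weightSum q n := by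
    refine weightSum_mono hpos ?_
    rw [← h4]
    exact (Nat.pow_le_pow_right two_pos (by omega : 2 * m ≤ order n)).trans
      (Nat.pow_log_le_self 2 (by omega))
  have h5 := mul_le_mul_of_nonneg_left h3 hK0
  have := h2 (m + 1)
  have := hK m
  linarith

/-- The extra 1 pays for the term `i = 0`, absent from the original condition. -/
lemma growthBound_of_bound {q : ℕ → ℝ} (hpos : ∀ k, 0 < q k) {C : ℝ} (h : ∀ n : ℕ, 1 ≤ n →
    1 / weightSum q n * ∑ k ∈ Icc 1 (order n), weightSum q (2 ^ k) ≤ C) :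
    GrowthBound q (C + 1) := by
  intro N
  have hI : ∑ k ∈ range N, weightSum q (2 ^ (k + 1)) = ∑ k ∈ Icc 1 N, weightSum q (2 ^ k) := by
    induction N with
    | zero => simp
    | succ N ih => rw [sum_range_succ, sum_Icc_succ_top (by omega), ih]
  have h1 := h (2 ^ N) Nat.one_le_two_pow
  rw [one_div, inv_mul_le_iff₀ (weightSum_pos hpos Nat.one_le_two_pow), order,
    Nat.log_pow one_lt_two] at h1
  have h2 : ∑ i ∈ range (N + 1), weightSum q (2 ^ i) =
      ∑ k ∈ Icc 1 N, weightSum q (2 ^ k) + weightSum q (2 ^ 0) := by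
    rw [sum_range_succ', hI]
  have h3 : weightSum q (2 ^ 0) ≤ weightSum q (2 ^ N) :=
    weightSum_mono hpos (Nat.pow_le_pow_right two_pos N.zero_le)
  linarith

lemma weightSum_mul_le {q : ℕ → ℝ} (hanti : Antitone q) (c n : ℕ) :
    weightSum q (c * n) ≤ c * weightSum q n := by
  induction c with
  | zero => simp [weightSum]
  | succ c ih =>
    rw [Nat.succ_mul]
    refine (weightSum_add_le hanti _ _).trans ?_
    push_cast; linarith

end WalshNorlund

namespace WalshNorlund

open Finset MeasureTheory

variable {L : ℕ}

/-! ### From the unit interval to the dyadic group -/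

/-- The Rademacher signs of a real number. -/
noncomputable def realSigns (t : ℝ) (j : ℕ) : ℝ := (-1) ^ dyadicDigit t j

/-- The first `L` digits of a real number. -/
noncomputable def toGroup (L : ℕ) (t : ℝ) : DyadicGroup L := fun j => (-1) ^ dyadicDigit t j

/-- The first `L` digits of the points of the `m`-th dyadic interval of length `2^{-L}`. -/
def cellDigits (L m : ℕ) : DyadicGroup L := fun j => (-1) ^ (m / 2 ^ (L - 1 - j) % 2)

lemma signs_toGroup (t : ℝ) {j : ℕ} (hj : j < L) : signs (toGroup L t) j = realSigns t j := by
  simp [signs, toGroup, realSigns, hj]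

lemma walsh_eq_paley (n : ℕ) (t : ℝ) : walsh n t = paley n (realSigns t) := by
  simp only [walsh, paley, realSigns, ← pow_mul, prod_pow_eq_pow_sum, mul_comm]

lemma paley_toGroup {n : ℕ} (hn : n < 2 ^ L) (t : ℝ) :
    paley n (signs (toGroup L t)) = paley n (realSigns t) := by
  rw [paley_eq_prod_range hn, paley_eq_prod_range hn]
  exact prod_congr rfl fun j hj => by rw [signs_toGroup t (mem_range.1 hj)]

lemma dirichletKernel_toGroup {k : ℕ} (hk : k ≤ 2 ^ L) (t : ℝ) :
    dirichletKernel L k (toGroup L t) = dirichlet k (realSigns t) :=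
  sum_congr rfl fun _ hi => paley_toGroup ((mem_range.1 hi).trans_le hk) t

/-- The first `L` digits are binary digits of one integer part, by `⌊y / k⌋ = ⌊⌊y⌋ / k⌋`.
Measurability and the shape of the cells both follow from this. -/
lemma toGroup_eq_cellDigits (L : ℕ) (t : ℝ) : toGroup L t = cellDigits L ⌊t * 2 ^ L⌋₊ := by
  funext j
  have h : t * 2 ^ ((j : ℕ) + 1) = t * 2 ^ L / ((2 ^ (L - 1 - j) : ℕ) : ℝ) := by
    rw [eq_div_iff (by positivity)]
    push_cast
    rw [mul_assoc, ← pow_add]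
    congr 2
    have := j.2
    omega
  simp only [toGroup, cellDigits, dyadicDigit, Real.digits, Fin.ofNat, Nat.cast_ofNat]
  rw [h, Nat.floor_div_natCast]

lemma cellDigits_injOn {m n : ℕ} (hm : m < 2 ^ L) (hn : n < 2 ^ L)
    (h : cellDigits L m = cellDigits L n) : m = n := by
  refine Nat.eq_of_testBit_eq fun i => ?_
  rcases lt_or_ge i L with hi | hi
  · have h1 := congrFun h ⟨L - 1 - i, by omega⟩
    simp only [cellDigits, show L - 1 - (L - 1 - i) = i by omega, ← Nat.toNat_testBit] at h1
    revert h1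
    cases m.testBit i <;> cases n.testBit i <;> simp
  · have h2 := Nat.pow_le_pow_right two_pos hi
    rw [Nat.testBit_lt_two_pow (hm.trans_le h2), Nat.testBit_lt_two_pow (hn.trans_le h2)]

lemma card_dyadicGroup (L : ℕ) : Fintype.card (DyadicGroup L) = 2 ^ L := by
  simp [DyadicGroup]

lemma exists_cellDigits (T : DyadicGroup L) : ∃ m < 2 ^ L, cellDigits L m = T := by
  have hinj : Function.Injective fun m : Fin (2 ^ L) => cellDigits L m := fun m n h =>
    Fin.ext (cellDigits_injOn m.2 n.2 h)
  have hb := (Fintype.bijective_iff_injective_and_card _).2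
    ⟨hinj, by rw [card_dyadicGroup, Fintype.card_fin]⟩
  obtain ⟨m, hm⟩ := hb.2 T
  exact ⟨m, m.2, hm⟩

lemma measurable_comp_toGroup {β : Type*} [MeasurableSpace β] (G : DyadicGroup L → β) :
    Measurable fun t => G (toGroup L t) := by
  simp only [toGroup_eq_cellDigits]
  exact (measurable_from_nat (f := fun m => G (cellDigits L m))).comp
    (Nat.measurable_floor.comp (measurable_id.mul_const _))

lemma measurableSet_cell (T : DyadicGroup L) : MeasurableSet (toGroup L ⁻¹' {T}) := by
  classical
  have h := measurable_comp_toGroup (fun x : DyadicGroup L => if x = T then (1 : ℕ) else 0)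
  have : toGroup L ⁻¹' {T} = (fun t => if toGroup L t = T then (1 : ℕ) else 0) ⁻¹' {1} := by
    ext t; simp
  rw [this]
  exact h (measurableSet_singleton 1)

instance : IsProbabilityMeasure unitMeasure := ⟨by simp [unitMeasure]⟩

lemma unitMeasure_cell (T : DyadicGroup L) :
    unitMeasure (toGroup L ⁻¹' {T}) = ENNReal.ofReal (2 ^ L)⁻¹ := by
  obtain ⟨m, hm, rfl⟩ := exists_cellDigits T
  have hL : (0 : ℝ) < 2 ^ L := by positivity
  rw [unitMeasure, Measure.restrict_apply (measurableSet_cell _)]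
  have h : toGroup L ⁻¹' {cellDigits L m} ∩ Set.Ico 0 1 =
      Set.Ico ((m : ℝ) / 2 ^ L) (((m : ℝ) + 1) / 2 ^ L) := by
    ext t
    simp only [Set.mem_inter_iff, Set.mem_preimage, Set.mem_singleton_iff, Set.mem_Ico,
      toGroup_eq_cellDigits, div_le_iff₀ hL, lt_div_iff₀ hL]
    constructor
    · rintro ⟨h1, h2, h3⟩
      have h4 : 0 ≤ t * 2 ^ L := by positivity
      have h5 : ⌊t * 2 ^ L⌋₊ < 2 ^ L := by
        rw [Nat.floor_lt h4]
        push_cast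
        nlinarith
      exact (Nat.floor_eq_iff h4).1 (cellDigits_injOn h5 hm h1)
    · rintro ⟨h1, h2⟩
      have h4 : 0 ≤ t * 2 ^ L := (Nat.cast_nonneg m).trans h1
      refine ⟨by rw [(Nat.floor_eq_iff h4).2 ⟨h1, h2⟩], nonneg_of_mul_nonneg_left h4 hL, ?_⟩
      have h5 : (m : ℝ) + 1 ≤ 2 ^ L := by exact_mod_cast hm
      by_contra! h6
      nlinarith
  rw [h, Real.volume_Ico]
  congr 1
  ring

lemma expect_eq (g : DyadicGroup L → ℝ) : univ.expect g = (2 ^ L)⁻¹ * ∑ x, g x := by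
  rw [show univ.expect g = univ.expect fun x => g x from rfl, Fintype.expect_eq_sum_div_card,
    card_dyadicGroup, div_eq_inv_mul]
  push_cast
  rfl

lemma iUnion_cell (L : ℕ) : ⋃ T : DyadicGroup L, toGroup L ⁻¹' {T} = Set.univ := by
  ext t; simp

lemma pairwise_disjoint_cell (L : ℕ) :
    Pairwise (Function.onFun Disjoint fun T : DyadicGroup L => toGroup L ⁻¹' {T}) :=
  fun _ _ h => Disjoint.preimage _ (Set.disjoint_singleton.2 h)

lemma lintegral_toGroup (h : DyadicGroup L → ℝ) (h0 : ∀ x, 0 ≤ h x) :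
    ∫⁻ t, ENNReal.ofReal (h (toGroup L t)) ∂unitMeasure = ENNReal.ofReal (univ.expect h) := by
  rw [← setLIntegral_univ, ← iUnion_cell L,
    lintegral_iUnion measurableSet_cell (pairwise_disjoint_cell L), tsum_fintype, expect_eq,
    mul_sum, ENNReal.ofReal_sum_of_nonneg fun x _ => mul_nonneg (by positivity) (h0 x)]
  refine sum_congr rfl fun T _ => ?_
  rw [setLIntegral_congr_fun (measurableSet_cell T) (g := fun _ => ENNReal.ofReal (h T))
    fun t ht => by rw [show toGroup L t = T from ht], setLIntegral_const, unitMeasure_cell,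
    mul_comm, ENNReal.ofReal_mul (by positivity)]

/-- The averages of `f` over the dyadic intervals of length `2^{-L}`. -/
noncomputable def cellAverage (f : ℝ → ℝ) (L : ℕ) (T : DyadicGroup L) : ℝ :=
  2 ^ L * ∫ t in toGroup L ⁻¹' {T}, f t ∂unitMeasure

/-- A Walsh function of order below `2^L` is constant on cells of length `2^{-L}`, so its
coefficient depends only on cell averages. -/
lemma coeff_eq_expect {f : ℝ → ℝ} (hf : Integrable f unitMeasure) {i : ℕ} (hi : i < 2 ^ L) :
    coeff f i = univ.expect fun T : DyadicGroup L => paley i (signs T) * cellAverage f L T := by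
  have hfi : Integrable (fun t => f t * walsh i t) unitMeasure := by
    refine hf.mul_bdd (c := 1) ?_ (Filter.Eventually.of_forall fun t => ?_)
    · rw [show walsh i = fun t => paley i (signs (toGroup L t)) from
        funext fun t => by rw [walsh_eq_paley, paley_toGroup hi]]
      exact (measurable_comp_toGroup fun x => paley i (signs x)).aestronglyMeasurable
    · rw [walsh_eq_paley, ← paley_toGroup hi, Real.norm_eq_abs, (isSign_signs _).abs_paley]
  rw [coeff, ← setIntegral_univ, ← iUnion_cell L, integral_iUnion_fintype measurableSet_cell
    (pairwise_disjoint_cell L) fun _ => hfi.integrableOn, expect_eq, mul_sum]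
  refine sum_congr rfl fun T _ => ?_
  rw [setIntegral_congr_fun (measurableSet_cell T) (g := fun t => f t * paley i (signs T))
    fun t ht => by
      rw [walsh_eq_paley, ← paley_toGroup hi, show toGroup L t = T from ht],
    integral_mul_const, cellAverage]
  field_simp

lemma partialSum_eq_conv {f : ℝ → ℝ} (hf : Integrable f unitMeasure) {k : ℕ} (hk : k ≤ 2 ^ L)
    (t : ℝ) : partialSum f k t = conv (dirichletKernel L k) (cellAverage f L) (toGroup L t) := by
  simp only [partialSum, conv, dirichletKernel, dirichlet, sum_mul, paley_signs_mul]
  rw [expect_sum_comm]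
  refine sum_congr rfl fun i hi => ?_
  have hi' := (mem_range.1 hi).trans_le hk
  rw [coeff_eq_expect hf hi', walsh_eq_paley, ← paley_toGroup hi', expect_mul]
  exact expect_congr rfl fun T _ => by ring

lemma norlundMean_eq_conv (q : ℕ → ℝ) {f : ℝ → ℝ} (hf : Integrable f unitMeasure) {n : ℕ}
    (hn : n ≤ 2 ^ L) (t : ℝ) :
    norlundMean q n f t = conv (norlundKernel L q n) (cellAverage f L) (toGroup L t) := by
  rw [norlundMean, conv_norlundKernel]
  congr 1
  refine sum_bij' (fun k _ => n - k) (fun j _ => n - j) ?_ ?_ ?_ ?_ ?_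
  · intro k hk; have := mem_Icc.1 hk; exact mem_range.2 (by omega)
  · intro j hj; have := mem_range.1 hj; exact mem_Icc.2 (by omega)
  · intro k hk; have := mem_Icc.1 hk; omega
  · intro j hj; have := mem_range.1 hj; omega
  · intro k hk
    have := mem_Icc.1 hk
    rw [show n - (n - k) = k by omega, partialSum_eq_conv hf (by omega : k ≤ 2 ^ L)]

lemma cellAverage_comp (h : DyadicGroup L → ℝ) :
    cellAverage (fun t => h (toGroup L t)) L = h := by
  funext T
  rw [cellAverage, setIntegral_congr_fun (measurableSet_cell T) (g := fun _ => h T)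
    fun t ht => by simp only; rw [show toGroup L t = T from ht], setIntegral_const,
    measureReal_def, unitMeasure_cell, ENNReal.toReal_ofReal (by positivity), smul_eq_mul,
    mul_inv_cancel_left₀ (by positivity)]

lemma memLp_comp_toGroup (h : DyadicGroup L → ℝ) (p : ℝ≥0∞) :
    MemLp (fun t => h (toGroup L t)) p unitMeasure := by
  refine MemLp.of_bound (measurable_comp_toGroup h).aestronglyMeasurable (∑ x, |h x|)
    (Filter.Eventually.of_forall fun t => ?_)
  exact single_le_sum (f := fun x => |h x|) (fun x _ => abs_nonneg _) (mem_univ _)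

/-! ### Sufficiency -/

lemma boundedLpLp_top_of_growthBound {q : ℕ → ℝ} (hpos : ∀ k, 0 < q k) (hanti : Antitone q)
    {C : ℝ} (hC : GrowthBound q C) : BoundedLpLp (norlundMaximal q) ⊤ := by
  have hC0 := hC.nonneg hpos
  refine ⟨(8 * C).toNNReal, fun f hf => ?_⟩
  have hfi : Integrable f unitMeasure := hf.integrable le_top
  set c := (eLpNorm f ⊤ unitMeasure).toReal with hc
  have hc' : eLpNorm f ⊤ unitMeasure = ENNReal.ofReal c :=
    (ENNReal.ofReal_toReal hf.2.ne).symm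
  have hfc : ∀ᵐ t ∂unitMeasure, ‖f t‖ ≤ c := by
    filter_upwards [ae_le_eLpNormEssSup (f := f) (μ := unitMeasure)] with t ht
    rw [← eLpNorm_exponent_top, hc', ← ofReal_norm] at ht
    exact (ENNReal.ofReal_le_ofReal_iff ENNReal.toReal_nonneg).1 ht
  have havg : ∀ (L : ℕ) (T : DyadicGroup L), |cellAverage f L T| ≤ c := by
    intro L T
    have h1 := norm_setIntegral_le_of_norm_le_const_ae (μ := unitMeasure) (f := f)
      (s := toGroup L ⁻¹' {T}) (C := c) (measure_lt_top _ _) (ae_restrict_of_ae hfc)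
    rw [measureReal_def, unitMeasure_cell, ENNReal.toReal_ofReal (by positivity),
      Real.norm_eq_abs] at h1
    rw [cellAverage, abs_mul, abs_of_pos (by positivity : (0 : ℝ) < 2 ^ L)]
    calc (2 : ℝ) ^ L * _ ≤ 2 ^ L * (c * (2 ^ L)⁻¹) :=
          mul_le_mul_of_nonneg_left h1 (by positivity)
      _ = c := by field_simp
  rw [hc', ← ENNReal.ofReal.eq_1, ← ENNReal.ofReal_mul (by positivity), eLpNorm_exponent_top]
  refine eLpNormEssSup_le_of_ae_enorm_bound (Filter.Eventually.of_forall fun t => ?_)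
  rw [enorm_eq_self]
  refine iSup₂_le fun n hn => ?_
  have hL : n ≤ 2 ^ n := Nat.lt_two_pow_self.le
  rw [norlundMean_eq_conv q hfi hL, ← ofReal_norm]
  exact ENNReal.ofReal_le_ofReal
    (abs_norlund_le_of_bounded hpos hanti hC hn hL (havg n) _)

lemma boundedHardyLp_one_of_growthBound {q : ℕ → ℝ} (hpos : ∀ k, 0 < q k) (hanti : Antitone q)
    {C : ℝ} (hC : GrowthBound q C) : BoundedHardyLp (norlundMaximal q) 1 := by
  have hC0 := hC.nonneg hpos
  refine ⟨(344 * C).toNNReal, fun f hf => ?_⟩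
  have hfi : Integrable f unitMeasure := memLp_one_iff_integrable.1 hf.1
  rw [hardyNorm, eLpNorm_one_eq_lintegral_enorm, eLpNorm_one_eq_lintegral_enorm]
  simp only [enorm_eq_self]
  set g : ℕ → ℝ → ℝ≥0∞ := fun L t => ⨆ n : ℕ, ⨆ _ : 1 ≤ n ∧ n ≤ 2 ^ L, ‖norlundMean q n f t‖ₑ
    with hg
  have hmax : norlundMaximal q f = fun t => ⨆ L, g L t := by
    funext t
    refine le_antisymm (iSup₂_le fun n hn => ?_) (iSup_le fun L => iSup₂_le fun n hn => ?_)
    · exact le_iSup_of_le n (le_iSup₂_of_le n ⟨hn, Nat.lt_two_pow_self.le⟩ le_rfl)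
    · exact le_iSup₂_of_le n hn.1 le_rfl
  set G : (L : ℕ) → DyadicGroup L → ℝ≥0∞ := fun L x => ⨆ n : ℕ, ⨆ _ : 1 ≤ n ∧ n ≤ 2 ^ L,
    ‖conv (norlundKernel L q n) (cellAverage f L) x‖ₑ with hG
  have hg_eq : ∀ L, g L = fun t => G L (toGroup L t) := by
    intro L
    funext t
    exact iSup_congr fun n => iSup_congr fun hn => by rw [norlundMean_eq_conv q hfi hn.2]
  have hmono : Monotone g := fun L L' h t => iSup₂_le fun n hn =>
    le_iSup₂_of_le n ⟨hn.1, hn.2.trans (Nat.pow_le_pow_right two_pos h)⟩ le_rfl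
  -- Monotone convergence reduces the full supremum to orders at most `2^L`, where the finite-group
  -- bound is uniform in `L`.
  rw [hmax, lintegral_iSup (fun L => by rw [hg_eq L]; exact measurable_comp_toGroup (G L)) hmono]
  refine iSup_le fun L => ?_
  set F : DyadicGroup L → ℝ := fun x =>
    (range (L + 1)).sup' ⟨0, by simp⟩ fun m => |level (cellAverage f L) m x| with hF_def
  have hF : ∀ m ≤ L, ∀ x, |level (cellAverage f L) m x| ≤ F x := fun m hm x =>
    le_sup' (fun m => |level (cellAverage f L) m x|) (mem_range.2 (Nat.lt_succ_of_le hm))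
  have hF0 : ∀ x, 0 ≤ F x := fun x => (abs_nonneg _).trans (hF 0 L.zero_le x)
  obtain ⟨B, hB1, hB2⟩ := exists_bound_of_maximal hpos hanti hC hF
  have hB0 : ∀ x, 0 ≤ B x := fun x => (abs_nonneg _).trans (hB2 1 le_rfl Nat.one_le_two_pow x)
  calc ∫⁻ t, g L t ∂unitMeasure ≤ ∫⁻ t, ENNReal.ofReal (B (toGroup L t)) ∂unitMeasure := by
        refine lintegral_mono fun t => ?_
        rw [hg_eq]
        refine iSup₂_le fun n hn => ?_
        rw [← ofReal_norm]
        exact ENNReal.ofReal_le_ofReal (hB2 n hn.1 hn.2 _)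
    _ = ENNReal.ofReal (univ.expect B) := lintegral_toGroup B hB0
    _ ≤ ENNReal.ofReal (344 * C * univ.expect F) := ENNReal.ofReal_le_ofReal hB1
    _ = ENNReal.ofReal (344 * C) * ∫⁻ t, ENNReal.ofReal (F (toGroup L t)) ∂unitMeasure := by
        rw [lintegral_toGroup F hF0, ENNReal.ofReal_mul (by positivity)]
    _ ≤ ENNReal.ofReal (344 * C) * ∫⁻ t, dyadicMaximal f t ∂unitMeasure := by
        refine mul_le_mul_right (lintegral_mono fun t => ?_) _
        obtain ⟨m, hm, hm'⟩ := exists_mem_eq_sup' (s := range (L + 1)) ⟨0, by simp⟩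
          fun m => |level (cellAverage f L) m (toGroup L t)|
        have hmL : m ≤ L := Nat.lt_succ_iff.1 (mem_range.1 hm)
        simp only [hF_def]
        rw [hm', level, ← partialSum_eq_conv hfi (Nat.pow_le_pow_right two_pos hmL),
          ← Real.norm_eq_abs, ofReal_norm]
        exact le_iSup (fun m => ‖partialSum f (2 ^ m) t‖ₑ) m

/-! ### Necessity -/

lemma alternating_succ_le (m : ℕ) : alternating (m + 1) ≤ 2 * 4 ^ m := by
  have := three_mul_alternating (m + 1)
  rw [pow_succ] at this
  omega

lemma alternating_le_two_pow (m : ℕ) : alternating m ≤ 2 ^ (2 * m) := by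
  have := three_mul_alternating m
  rw [pow_mul]
  norm_num
  omega

lemma exists_growth_of_boundedLpLp_top {q : ℕ → ℝ} (hpos : ∀ k, 0 < q k) (hanti : Antitone q)
    (h : BoundedLpLp (norlundMaximal q) ⊤) :
    ∃ C : ℝ, ∀ n : ℕ, 1 ≤ n →
      1 / weightSum q n * ∑ k ∈ Icc 1 (order n), weightSum q (2 ^ k) ≤ C := by
  obtain ⟨K, hK⟩ := h
  refine exists_growth_of_four_pow hpos hanti (K := 16 * K) fun m => ?_
  set L := 2 * (m + 1) with hL
  set n := alternating (m + 1) with hn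
  have hn1 : 1 ≤ n := by
    have := three_mul_alternating (m + 1)
    have : 4 ^ m ≠ 0 := by positivity
    rw [pow_succ] at *
    omega
  have hQ := weightSum_pos hpos hn1
  set g : DyadicGroup L → ℝ := fun x => paley n (signs x) * testSum (m + 1) (signs x) with hg
  have hg1 : ∀ x, |g x| ≤ 1 := fun x => by
    rw [hg, abs_mul, (isSign_signs x).abs_paley, one_mul,
      abs_of_nonneg ((isSign_signs x).testSum_nonneg _)]
    exact (isSign_signs x).testSum_le_one _
  have hbound := hK _ (memLp_comp_toGroup g ⊤)
  have hnorm : eLpNorm (fun t => g (toGroup L t)) ⊤ unitMeasure ≤ 1 := by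
    rw [eLpNorm_exponent_top, ← ENNReal.ofReal_one]
    exact eLpNormEssSup_le_of_ae_bound (Filter.Eventually.of_forall fun t => hg1 _)
  have hae : ∀ᵐ t ∂unitMeasure, norlundMaximal q (fun t => g (toGroup L t)) t ≤ K := by
    filter_upwards [ae_le_eLpNormEssSup (f := norlundMaximal q fun t => g (toGroup L t))
      (μ := unitMeasure)] with t ht
    rw [enorm_eq_self, ← eLpNorm_exponent_top] at ht
    exact ht.trans (hbound.trans (mul_le_of_le_one_right zero_le hnorm))
  -- The essential bound holds somewhere on the cell of 0, which has positive measure. The mean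
  -- considered is constant on that cell, so the value at the identity is controlled.
  obtain ⟨t, ht, ht1⟩ : ∃ t, norlundMaximal q (fun t => g (toGroup L t)) t ≤ K ∧
      toGroup L t = 1 := by
    by_contra! H
    have h0 : unitMeasure (toGroup L ⁻¹' {1}) = 0 :=
      measure_mono_null (fun t ht hle => H t hle ht) hae
    rw [unitMeasure_cell, ENNReal.ofReal_eq_zero] at h0
    exact absurd h0 (not_le.2 (by positivity))
  have hfi := memLp_one_iff_integrable.1 (memLp_comp_toGroup g 1)
  have hle : ‖norlundMean q n (fun t => g (toGroup L t)) t‖ₑ ≤ K :=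
    (le_iSup₂ (f := fun n (_ : 1 ≤ n) => ‖norlundMean q n (fun t => g (toGroup L t)) t‖ₑ)
      n hn1).trans ht
  rw [norlundMean_eq_conv q hfi (alternating_le_two_pow (m + 1)), cellAverage_comp, ht1] at hle
  have hle' : conv (norlundKernel L q n) g 1 ≤ K := by
    refine (le_abs_self _).trans ?_
    rw [← ofReal_norm, Real.norm_eq_abs] at hle
    exact (ENNReal.ofReal_le_ofReal_iff K.coe_nonneg).1 (by rwa [ENNReal.ofReal_coe_nnreal])
  have hconv : conv (norlundKernel L q n) g 1 = 1 / weightSum q n * univ.expect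
      (fun x : DyadicGroup L => norlundSum q n (signs x) *
        (paley n (signs x) * testSum (m + 1) (signs x))) := by
    rw [conv, mul_expect]
    exact expect_congr rfl fun x _ => by rw [one_mul, norlundKernel, mul_assoc]
  rw [hconv, one_div, inv_mul_le_iff₀ hQ] at hle'
  have h1 := sum_weightSum_le_expect hpos hanti (L := L) (m := m + 1) le_rfl
  -- With the factor 8 of the kernel lower bound, this gives the constant 16.
  have h2 : weightSum q n ≤ 2 * weightSum q (4 ^ m) := by
    refine (weightSum_mono hpos (alternating_succ_le m)).trans ?_
    exact_mod_cast weightSum_mul_le hanti 2 (4 ^ m)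
  have h3 := mul_le_mul_of_nonneg_right h2 K.coe_nonneg
  linarith

/-- The martingale difference `r_M D_{2^M} = D_{2^{M+1}} - D_{2^M}` on the dyadic group. -/
noncomputable def atomKernel (L M : ℕ) (x : DyadicGroup L) : ℝ :=
  dirichletKernel L (2 ^ (M + 1)) x + (-1) * dirichletKernel L (2 ^ M) x

lemma atomKernel_toGroup {L L' M : ℕ} (hL : M + 1 ≤ L) (hL' : M + 1 ≤ L') :
    (fun t => atomKernel L M (toGroup L t)) = fun t => atomKernel L' M (toGroup L' t) := by
  funext t
  have h : ∀ {L}, M + 1 ≤ L → 2 ^ (M + 1) ≤ 2 ^ L ∧ 2 ^ M ≤ 2 ^ L := fun hL =>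
    ⟨Nat.pow_le_pow_right two_pos hL, Nat.pow_le_pow_right two_pos (by omega)⟩
  simp only [atomKernel]
  rw [dirichletKernel_toGroup (h hL).1, dirichletKernel_toGroup (h hL).2,
    dirichletKernel_toGroup (h hL').1, dirichletKernel_toGroup (h hL').2]

/-- The partial sum of order `2^n` is zero for `n ≤ M` and the whole function for `n > M`. -/
lemma dyadicMaximal_atom_le {M : ℕ} (hL : M + 1 ≤ L) (t : ℝ) :
    dyadicMaximal (fun t => atomKernel L M (toGroup L t)) t ≤
      ‖atomKernel L M (toGroup L t)‖ₑ := by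
  refine iSup_le fun n => ?_
  set L' := max n (M + 1) with hL'
  have h1 : M + 1 ≤ L' := le_max_right _ _
  rw [show atomKernel L M (toGroup L t) = atomKernel L' M (toGroup L' t) from
    congrFun (atomKernel_toGroup hL h1) t, atomKernel_toGroup hL h1,
    partialSum_eq_conv (memLp_one_iff_integrable.1 (memLp_comp_toGroup (atomKernel L' M) 1))
      (Nat.pow_le_pow_right two_pos (le_max_left n (M + 1))), cellAverage_comp]
  have h2 : ∀ x, conv (dirichletKernel L' (2 ^ n)) (atomKernel L' M) x =
      dirichletKernel L' (2 ^ min n (M + 1)) x - dirichletKernel L' (2 ^ min n M) x := by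
    intro x
    unfold atomKernel
    rw [conv_add_right, conv_const_mul_right, conv_dirichlet_two_pow (le_max_left _ _) h1,
      conv_dirichlet_two_pow (le_max_left _ _) (by omega)]
    ring
  rw [h2]
  rcases le_or_gt n M with h | h
  · rw [min_eq_left h, min_eq_left (by omega), sub_self, enorm_zero]
    exact zero_le
  · rw [min_eq_right h.le, min_eq_right (by omega), atomKernel, neg_one_mul, sub_eq_add_neg]

lemma exists_growth_of_boundedHardyLp_one {q : ℕ → ℝ} (hpos : ∀ k, 0 < q k)
    (hanti : Antitone q) (h : BoundedHardyLp (norlundMaximal q) 1) :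
    ∃ C : ℝ, ∀ n : ℕ, 1 ≤ n →
      1 / weightSum q n * ∑ k ∈ Icc 1 (order n), weightSum q (2 ^ k) ≤ C := by
  obtain ⟨K, hK⟩ := h
  refine exists_growth_of_four_pow hpos hanti (K := 128 * K) fun m => ?_
  set M := 2 * (m + 1) with hM
  set L := M + 1 with hL
  set n := alternating (m + 1) with hn
  have hnM : n ≤ 2 ^ M := alternating_le_two_pow (m + 1)
  have hN1 : 1 ≤ 2 ^ M + n := Nat.one_le_two_pow.trans (Nat.le_add_right _ _)
  have hQ := weightSum_pos hpos hN1
  set f : ℝ → ℝ := fun t => atomKernel L M (toGroup L t) with hf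
  have hmem : MemLp f 1 unitMeasure := memLp_comp_toGroup (atomKernel L M) 1
  have hfi := memLp_one_iff_integrable.1 hmem
  have hhardy : hardyNorm f 1 ≤ ENNReal.ofReal 2 := by
    rw [hardyNorm, eLpNorm_one_eq_lintegral_enorm]
    simp only [enorm_eq_self]
    have hD := dirichletKernel_nonneg (L := L)
    calc ∫⁻ t, dyadicMaximal f t ∂unitMeasure
        ≤ ∫⁻ t, ENNReal.ofReal ((fun x => dirichletKernel L (2 ^ (M + 1)) x +
            dirichletKernel L (2 ^ M) x) (toGroup L t)) ∂unitMeasure := by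
          refine lintegral_mono fun t => (dyadicMaximal_atom_le le_rfl t).trans ?_
          rw [← ofReal_norm]
          refine ENNReal.ofReal_le_ofReal ((norm_add_le _ _).trans (le_of_eq ?_))
          rw [neg_one_mul, norm_neg, Real.norm_of_nonneg (hD _ _), Real.norm_of_nonneg (hD _ _)]
      _ = ENNReal.ofReal 2 := by
          rw [lintegral_toGroup _ fun x => add_nonneg (hD _ x) (hD _ x), expect_add_distrib]
          congr 1
          have h1 : univ.expect (fun x => dirichletKernel L (2 ^ (M + 1)) x) = 1 :=
            expect_dirichlet_two_pow le_rfl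
          have h2 : univ.expect (fun x => dirichletKernel L (2 ^ M) x) = 1 :=
            expect_dirichlet_two_pow M.le_succ
          rw [h1, h2]; norm_num
  have hbound := (hK f ⟨hmem, hhardy.trans_lt ENNReal.ofReal_lt_top⟩).trans
    (mul_le_mul_right hhardy _)
  have hmean : ∀ t, ‖norlundMean q (2 ^ M + n) f t‖ₑ = ENNReal.ofReal ((fun x : DyadicGroup L =>
      1 / weightSum q (2 ^ M + n) * |norlundSum q n (signs x)|) (toGroup L t)) := by
    intro t
    rw [norlundMean_eq_conv q hfi (L := L) (by rw [hL, pow_succ]; omega), hf, cellAverage_comp]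
    unfold atomKernel
    rw [conv_norlundKernel_atom q hnM le_rfl, ← ofReal_norm, Real.norm_eq_abs, abs_mul, abs_mul,
      (isSign_signs _).abs, one_mul, abs_of_pos (one_div_pos.2 hQ)]
  have hle : ENNReal.ofReal (univ.expect fun x : DyadicGroup L =>
      1 / weightSum q (2 ^ M + n) * |norlundSum q n (signs x)|) ≤ ENNReal.ofReal (K * 2) := by
    rw [← lintegral_toGroup _ fun x => mul_nonneg (one_div_pos.2 hQ).le (abs_nonneg _),
      ENNReal.ofReal_mul K.coe_nonneg, ENNReal.ofReal_coe_nnreal]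
    refine le_trans ?_ hbound
    rw [eLpNorm_one_eq_lintegral_enorm]
    refine lintegral_mono fun t => ?_
    rw [enorm_eq_self, ← hmean]
    exact le_iSup₂ (f := fun n (_ : 1 ≤ n) => ‖norlundMean q n f t‖ₑ) (2 ^ M + n) hN1
  rw [ENNReal.ofReal_le_ofReal_iff (mul_nonneg K.coe_nonneg two_pos.le), ← mul_expect, one_div,
    inv_mul_le_iff₀ hQ] at hle
  have h1 := sum_weightSum_le_expect hpos hanti (L := L) (m := m + 1) (by omega)
  have h2 : univ.expect (fun x : DyadicGroup L => norlundSum q n (signs x) *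
      (paley n (signs x) * testSum (m + 1) (signs x))) ≤
      univ.expect fun x : DyadicGroup L => |norlundSum q n (signs x)| := by
    refine expect_le_expect fun x _ => (le_abs_self _).trans ?_
    rw [abs_mul, abs_mul, (isSign_signs x).abs_paley, one_mul,
      abs_of_nonneg ((isSign_signs x).testSum_nonneg _)]
    exact mul_le_of_le_one_right (abs_nonneg _) ((isSign_signs x).testSum_le_one _)
  -- The order is at most `(4 + 2) 4^m`. The factors 8 here, 8 from the kernel lower bound and 2
  -- from the Hardy norm make 128.
  have h3 : weightSum q (2 ^ M + n) ≤ 8 * weightSum q (4 ^ m) := by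
    refine (weightSum_mono hpos (?_ : 2 ^ M + n ≤ 8 * 4 ^ m)).trans
      (by exact_mod_cast weightSum_mul_le hanti 8 (4 ^ m))
    have h4 : 2 ^ M = 4 * 4 ^ m := by rw [hM, pow_mul, pow_succ]; norm_num [mul_comm]
    have := alternating_succ_le m
    omega
  have h5 := mul_le_mul_of_nonneg_right h3 (mul_nonneg K.coe_nonneg two_pos.le)
  linarith

end WalshNorlund

/-! ### The equivalence, with the growth condition as hub. -/

theorem mainTheorem2 (q : ℕ → ℝ) (hpos : ∀ k, 0 < q k) (hanti : Antitone q) :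
    List.TFAE
      [WalshNorlund.BoundedLpLp (WalshNorlund.norlundMaximal q) ⊤,
       WalshNorlund.BoundedHardyLp (WalshNorlund.norlundMaximal q) 1,
       ∃ C : ℝ, ∀ n : ℕ, 1 ≤ n →
         1 / WalshNorlund.weightSum q n *
           ∑ k ∈ Finset.Icc 1 (WalshNorlund.order n), WalshNorlund.weightSum q (2 ^ k) ≤ C] := by
  tfae_have 1 → 3 := WalshNorlund.exists_growth_of_boundedLpLp_top hpos hanti
  tfae_have 2 → 3 := WalshNorlund.exists_growth_of_boundedHardyLp_one hpos hanti
  tfae_have 3 → 1 := fun ⟨_, hC⟩ => WalshNorlund.boundedLpLp_top_of_growthBound hpos hanti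
    (WalshNorlund.growthBound_of_bound hpos hC)
  tfae_have 3 → 2 := fun ⟨_, hC⟩ => WalshNorlund.boundedHardyLp_one_of_growthBound hpos hanti
    (WalshNorlund.growthBound_of_bound hpos hC)
  tfae_finish
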